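/- **Model.** Fix real parameters $0\le p<1$, $\alpha,\beta\ge 0$ with $0<\alpha+\beta\le 1$, and $\delta_{in},\delta_{out}\ge 0$. Let $G_0$ be any finite directed multigraph with at least one edge. Degrees and neighbours are counted with multiplicity, and loops are allowed. Given $G(t)$, starting from $G(0)=G_0$, the graph $G(t+1)$ is obtained by exactly one of the following random events. - With probability $(1-p)\alpha$: add a new node $u$ and an edge from $u$ to an existing node $v$ chosen with probability proportional to $d_{in}(v)+\delta_{in}$. - With probability $(1-p)\beta$: add a new node $v$ and an edge to $v$ from an existing node $u$ chosen with probability proportional to $d_{out}(u)+\delta_{out}$. - With probability $(1-p)(1-\alpha-\beta)$: add an edge from an existing node $u$ to an existing node $v$, chosen independently with probabilities proportional to $d_{out}(u)+\delta_{out}$ and $d_{in}(v)+\delta_{in}$ respectively. - With probability $p$ (K22 event): choose a node $u_1$ with probability proportional to $d_{out}(u_1)$; choose uniformly (with multiplicity) an out-neighbour $v_1$ of $u_1$, then an in-neighbour $u_2$ of $v_1$, then an out-neighbour $v_2$ of $u_2$ (the cases $u_2=u_1$ and $v_2=v_1$ are allowed); add an edge from $u_1$ to $v_2$. Let $N(t)$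 be the number of nodes of $G(t)$, let $N_{in}(i,t)$ be the number of nodes of in-degree $i$ and $N_{out}(o,t)$ the number of nodes of out-degree $o$. Put $$A=p+\frac{(1-p)(1-\beta)}{1+(1-p)(\alpha+\beta)\delta_{in}},\qquad B=p+\frac{(1-p)(1-\alpha)}{1+(1-p)(\alpha+\beta)\delta_{out}}.$$ **Theorem.** 1. Suppose $p>0$ or $\beta<1$, and $\alpha\delta_{in}+\beta>0$. Then there are a sequence $(P(i))_{i\ge0}$ and a constant $C>0$, not depending on $G_0$, such that for every $G_0$ and every $i\ge 0$, as $t\to\infty$, $$\frac{N_{in}(i,t)}{N(t)}\to P(i)\ \text{ in probability},\qquad \frac{N_{in}(i,t)}{t}\to(1-p)(\alpha+\beta)P(i)\ \text{ in probability},$$ $$\frac{\mathbb E[N_{in}(i,t)]}{t}\to(1-p)(\alpha+\beta)P(i)$$ (the expectations being finite), and $$\lim_{i\to\infty}\frac{P(i)}{C\,i^{-(1+1/A)}}=1.$$ 2. Suppose $p>0$ or $\alpha<1$, and $\beta\delta_{out}+\alpha>0$. Then there are a sequence $(P_{out}(o))_{o\ge0}$ and a constant $C'>0$, not depending on $G_0$,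 such that for every $G_0$ and every $o\ge0$ the same three limits hold with $N_{out}(o,t)$ and $P_{out}(o)$ in place of $N_{in}(i,t)$ and $P(i)$, and $$\lim_{o\to\infty}\frac{P_{out}(o)}{C'\,o^{-(1+1/B)}}=1.$$ -/

import Mathlib

open Filter Topology MeasureTheory Asymptotics
open scoped ENNReal

noncomputable section

/-- A finite directed multigraph (loops and parallel edges allowed) with at least one edge.
The vertices are `Fin n`, the edges are `Fin m`, and the edge `e` goes from `src e` to `tgt e`. -/
structure DiMultigraph where
  n : ℕ
  m : ℕ
  src : Fin m → Fin n
  tgt : Fin m → Fin n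
  edge_pos : 0 < m

namespace DiMultigraph

instance : MeasurableSpace DiMultigraph := ⊤

/-- The edges leaving `u`. -/
def outEdges (G : DiMultigraph) (u : Fin G.n) : Finset (Fin G.m) :=
  Finset.univ.filter (fun e => G.src e = u)

/-- The edges reaching `v`. -/
def inEdges (G : DiMultigraph) (v : Fin G.n) : Finset (Fin G.m) :=
  Finset.univ.filter (fun e => G.tgt e = v)

/-- Out-degree, with multiplicity. -/
def outDeg (G : DiMultigraph) (u : Fin G.n) : ℕ := (G.outEdges u).card

/-- In-degree, with multiplicity. -/
def inDeg (G : DiMultigraph) (v : Fin G.n) : ℕ := (G.inEdges v).card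

/-- The number of vertices of in-degree `i`. -/
def inCount (G : DiMultigraph) (i : ℕ) : ℕ :=
  (Finset.univ.filter (fun v : Fin G.n => G.inDeg v = i)).card

/-- The number of vertices of out-degree `o`. -/
def outCount (G : DiMultigraph) (o : ℕ) : ℕ :=
  (Finset.univ.filter (fun u : Fin G.n => G.outDeg u = o)).card

/-- Add an edge from the existing vertex `u` to the existing vertex `v`. -/
def addEdge (G : DiMultigraph) (u v : Fin G.n) : DiMultigraph where
  n := G.n
  m := G.m + 1
  src := Fin.snoc (α := fun _ => Fin G.n) G.src u
  tgt := Fin.snoc (α := fun _ => Fin G.n) G.tgt v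
  edge_pos := Nat.succ_pos _

/-- Add an isolated vertex; it is the vertex `Fin.last G.n` of the new graph. -/
def addVertex (G : DiMultigraph) : DiMultigraph where
  n := G.n + 1
  m := G.m
  src := fun e => (G.src e).castSucc
  tgt := fun e => (G.tgt e).castSucc
  edge_pos := G.edge_pos

/-- Add a new vertex and an edge from it to the existing vertex `v`. -/
def addSource (G : DiMultigraph) (v : Fin G.n) : DiMultigraph :=
  G.addVertex.addEdge (Fin.last G.n) v.castSucc

/-- Add a new vertex and an edge from the existing vertex `u` to it. -/
def addTarget (G : DiMultigraph) (u : Fin G.n) : DiMultigraph :=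
  G.addVertex.addEdge u.castSucc (Fin.last G.n)

theorem outEdges_src_nonempty (G : DiMultigraph) (e : Fin G.m) :
    (G.outEdges (G.src e)).Nonempty := ⟨e, by simp [outEdges]⟩

theorem inEdges_tgt_nonempty (G : DiMultigraph) (e : Fin G.m) :
    (G.inEdges (G.tgt e)).Nonempty := ⟨e, by simp [inEdges]⟩

theorem outWeight_ne_zero (G : DiMultigraph) (δ : ℝ) :
    ∑' u : Fin G.n, ((G.outDeg u : ℝ≥0∞) + ENNReal.ofReal δ) ≠ 0 := by
  intro h
  have h' := ENNReal.tsum_eq_zero.1 h (G.src ⟨0, G.edge_pos⟩)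
  have h2 : G.outDeg (G.src ⟨0, G.edge_pos⟩) = 0 := by
    have := (add_eq_zero.1 h').1
    exact_mod_cast this
  exact (G.outEdges_src_nonempty _).card_pos.ne' h2

theorem inWeight_ne_zero (G : DiMultigraph) (δ : ℝ) :
    ∑' v : Fin G.n, ((G.inDeg v : ℝ≥0∞) + ENNReal.ofReal δ) ≠ 0 := by
  intro h
  have h' := ENNReal.tsum_eq_zero.1 h (G.tgt ⟨0, G.edge_pos⟩)
  have h2 : G.inDeg (G.tgt ⟨0, G.edge_pos⟩) = 0 := by
    have := (add_eq_zero.1 h').1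
    exact_mod_cast this
  exact (G.inEdges_tgt_nonempty _).card_pos.ne' h2

theorem outWeight_ne_top (G : DiMultigraph) (δ : ℝ) :
    ∑' u : Fin G.n, ((G.outDeg u : ℝ≥0∞) + ENNReal.ofReal δ) ≠ ⊤ := by
  rw [tsum_fintype]
  exact ENNReal.sum_ne_top.2 fun u _ => by simp

theorem inWeight_ne_top (G : DiMultigraph) (δ : ℝ) :
    ∑' v : Fin G.n, ((G.inDeg v : ℝ≥0∞) + ENNReal.ofReal δ) ≠ ⊤ := by
  rw [tsum_fintype]
  exact ENNReal.sum_ne_top.2 fun u _ => by simp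

/-- A random vertex, `u` being chosen with probability proportional to `d_out(u) + δ`. -/
def chooseByOut (G : DiMultigraph) (δ : ℝ) : PMF (Fin G.n) :=
  PMF.normalize (fun u => (G.outDeg u : ℝ≥0∞) + ENNReal.ofReal δ)
    (G.outWeight_ne_zero δ) (G.outWeight_ne_top δ)

/-- A random vertex, `v` being chosen with probability proportional to `d_in(v) + δ`. -/
def chooseByIn (G : DiMultigraph) (δ : ℝ) : PMF (Fin G.n) :=
  PMF.normalize (fun v => (G.inDeg v : ℝ≥0∞) + ENNReal.ofReal δ)
    (G.inWeight_ne_zero δ) (G.inWeight_ne_top δ)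

theorem outEdges_nonempty_of_mem_support (G : DiMultigraph) (u : Fin G.n)
    (hu : u ∈ (G.chooseByOut 0).support) : (G.outEdges u).Nonempty := by
  rw [chooseByOut, PMF.mem_support_normalize_iff] at hu
  rw [← Finset.card_pos, Nat.pos_iff_ne_zero]
  intro h
  exact hu (by simp [outDeg, h])

/-- The K22 event: choose `u₁` with probability proportional to its out-degree, an out-neighbour
`v₁` of `u₁`, an in-neighbour `u₂` of `v₁` and an out-neighbour `v₂` of `u₂`, each uniformly and
with multiplicity (that is, a uniform edge out of `u₁`, into `v₁`, out of `u₂`), and add an edge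
from `u₁` to `v₂`. The cases `u₂ = u₁` and `v₂ = v₁` are allowed. -/
def k22Step (G : DiMultigraph) : PMF DiMultigraph :=
  (G.chooseByOut 0).bindOnSupport fun u₁ hu₁ =>
    (PMF.uniformOfFinset (G.outEdges u₁) (G.outEdges_nonempty_of_mem_support u₁ hu₁)).bind
      fun e₁ =>
        (PMF.uniformOfFinset (G.inEdges (G.tgt e₁)) (G.inEdges_tgt_nonempty e₁)).bind fun e₂ =>
          (PMF.uniformOfFinset (G.outEdges (G.src e₂)) (G.outEdges_src_nonempty e₂)).bind fun e₃ =>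
            PMF.pure (G.addEdge u₁ (G.tgt e₃))

end DiMultigraph

/-- The parameters of the model. -/
structure K22Params where
  p : ℝ
  α : ℝ
  β : ℝ
  δin : ℝ
  δout : ℝ
  p_nonneg : 0 ≤ p
  p_le_one : p ≤ 1
  α_nonneg : 0 ≤ α
  β_nonneg : 0 ≤ β
  add_le_one : α + β ≤ 1
  δin_nonneg : 0 ≤ δin
  δout_nonneg : 0 ≤ δout

/-- The four kinds of events that may happen at a time step. -/
inductive K22Event
  | newSource
  | newTarget
  | innerEdge
  | k22

instance : Fintype K22Event where
  elems := ⟨[K22Event.newSource, K22Event.newTarget, K22Event.innerEdge, K22Event.k22], by simp⟩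
  complete := by intro ev; cases ev <;> simp

namespace K22Params

/-- The probabilities of the four kinds of events. -/
def eventProb (θ : K22Params) : K22Event → ℝ
  | .newSource => (1 - θ.p) * θ.α
  | .newTarget => (1 - θ.p) * θ.β
  | .innerEdge => (1 - θ.p) * (1 - θ.α - θ.β)
  | .k22 => θ.p

theorem eventProb_nonneg (θ : K22Params) (ev : K22Event) : 0 ≤ θ.eventProb ev := by
  have h1 := θ.p_nonneg
  have h2 : 0 ≤ 1 - θ.p := sub_nonneg.2 θ.p_le_one
  have h3 := θ.α_nonneg
  have h4 := θ.β_nonneg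
  have h5 : 0 ≤ 1 - θ.α - θ.β := by linarith [θ.add_le_one]
  cases ev <;> simp only [eventProb] <;> positivity

theorem sum_eventProb (θ : K22Params) : ∑ ev : K22Event, θ.eventProb ev = 1 := by
  have h : ∑ ev : K22Event, θ.eventProb ev = θ.eventProb .newSource + (θ.eventProb .newTarget +
      (θ.eventProb .innerEdge + (θ.eventProb .k22 + 0))) := rfl
  rw [h]
  simp only [eventProb]
  ring

/-- The random kind of event of a time step. -/
def event (θ : K22Params) : PMF K22Event :=
  PMF.ofFintype (fun ev => ENNReal.ofReal (θ.eventProb ev)) (by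
    rw [← ENNReal.ofReal_sum_of_nonneg fun ev _ => θ.eventProb_nonneg ev, sum_eventProb,
      ENNReal.ofReal_one])

/-- One time step: the conditional law of the next graph given that the current one is `G`. -/
def step (θ : K22Params) (G : DiMultigraph) : PMF DiMultigraph :=
  θ.event.bind fun
    | .newSource => (G.chooseByIn θ.δin).bind fun v => PMF.pure (G.addSource v)
    | .newTarget => (G.chooseByOut θ.δout).bind fun u => PMF.pure (G.addTarget u)
    | .innerEdge => (G.chooseByOut θ.δout).bind fun u =>
        (G.chooseByIn θ.δin).bind fun v => PMF.pure (G.addEdge u v)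
    | .k22 => G.k22Step

/-- The law of the random graph after `t` steps of the model started from `G₀`. -/
def law (θ : K22Params) (G₀ : DiMultigraph) : ℕ → PMF DiMultigraph
  | 0 => PMF.pure G₀
  | t + 1 => (law θ G₀ t).bind θ.step

/-- The constant `A` of the in-degree exponent. -/
def A (θ : K22Params) : ℝ :=
  θ.p + (1 - θ.p) * (1 - θ.β) / (1 + (1 - θ.p) * (θ.α + θ.β) * θ.δin)

/-- The constant `B` of the out-degree exponent. -/
def B (θ : K22Params) : ℝ :=
  θ.p + (1 - θ.p) * (1 - θ.α) / (1 + (1 - θ.p) * (θ.α + θ.β) * θ.δout)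

end K22Params

/-- Convergence in probability to the constant `c` of the random variables `X t`, where `X t` is a
function of a random element of law `μ t`. -/
def TendstoInProb {S : Type*} [MeasurableSpace S] (μ : ℕ → PMF S) (X : ℕ → S → ℝ) (c : ℝ) : Prop :=
  ∀ ε : ℝ, 0 < ε → Tendsto (fun t => (μ t).toMeasure {s | ε ≤ |X t s - c|}) atTop (𝓝 0)

end

/-!
Both kinds of degree evolve as in linear preferential attachment. In a K22 event the three edges
walked are each marginally uniform: the first one by the choice of its source by out-degree, and the
others because resampling a uniform edge among those with the same target, or the same source,
preserves the uniform law (`DiMultigraph.uniform_bind_inEdges`). Hence the new edge leaves a vertex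
chosen by out-degree and reaches a vertex chosen by in-degree, although these are dependent
(`DiMultigraph.map_tgt_snd_k22Path`, `DiMultigraph.map_src_fst_k22Path`).

The mean change in a step of the number `N i` of vertices of degree `i`, in a graph with `m` edges
and `n` vertices, is therefore a difference of flows `p j N j / m + q (j + δ) N j / (m + δ n)` for
`j = i - 1` and `j = i`, plus a source term for `i ≤ 1`. The structure `IsAttachmentKernel` records
this, and the theorem is derived from it for in-degrees and out-degrees at once. Since `n / m` tends
to `γ`, the equilibrium proportions `x i = lim N i / m` satisfy
`x i (1 + A i + c δ) = (A (i - 1) + c δ) x (i - 1) + source`, with `c = q / (1 + γ δ)` and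
`A = p + c`.

The convergence is a second moment computation. Put `D i = N i - x i m` and `E = n - γ m`. The mean
change of `D i` in a step is `((A (i - 1) + c δ) D (i - 1) - (A i + c δ) D i) / m`, up to an error
of order `|E| / m`. The second term is restoring and can be dropped from the expansion of `D i ^ 2`,
so by the inequality of arithmetic and geometric means `D i ^ 2` grows in mean at rate at most
`1 / (2 m)`, up to a forcing `O((D (i - 1) ^ 2 + E ^ 2) / m + 1)`
(`IsAttachmentKernel.step_countDev_sq_le`). By induction on `i`, the second moment of `D i` is of
linear growth (`IsAttachmentKernel.countDev_sq_le`), and Chebyshev's inequality gives the limits in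
probability. The mean converges since the square of the mean of `D i` is at most its second moment.

For `i ≥ 2` the equilibrium equation makes `x i / x 1` a quotient of two rising factorials whose
base points differ by `1 + 1 / A`, and Euler's limit formula for the Gamma function gives the power
law (`AttachmentParams.density_isEquivalent`).
-/

/-! ### Expectations under finitely supported laws -/

namespace PMF

variable {S ι : Type*}

theorem support_bind_finite {μ : PMF ι} (hμ : μ.support.Finite) {κ : ι → PMF S}
    (hκ : ∀ a, (κ a).support.Finite) : (μ.bind κ).support.Finite := by
  rw [support_bind]
  exact hμ.biUnion fun a _ => hκ a

variable [MeasurableSpace S]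

theorem ae_mem_support [MeasurableSingletonClass S] (μ : PMF S) (hμ : μ.support.Finite) :
    ∀ᵐ s ∂μ.toMeasure, s ∈ μ.support := by
  rw [ae_iff]
  have : MeasurableSet {s | s ∉ μ.support} := hμ.measurableSet.compl
  rw [toMeasure_apply_eq_zero_iff _ this]
  exact Set.disjoint_left.2 fun a ha hb => hb ha

theorem toMeasure_bind_eq_sum {μ : PMF ι} (hμ : μ.support.Finite) (κ : ι → PMF S) :
    (μ.bind κ).toMeasure = ∑ a ∈ hμ.toFinset, μ a • (κ a).toMeasure := by
  ext s hs
  rw [toMeasure_bind_apply _ _ _ hs, Measure.finsetSum_apply, tsum_eq_sum (s := hμ.toFinset)]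
  · simp
  · intro a ha
    have : μ a = 0 := by simpa using ha
    simp [this]

theorem integrable_bind {μ : PMF ι} (hμ : μ.support.Finite) {κ : ι → PMF S} {f : S → ℝ}
    (hf : ∀ a, Integrable f (κ a).toMeasure) : Integrable f (μ.bind κ).toMeasure := by
  rw [toMeasure_bind_eq_sum hμ]
  exact integrable_finsetSum_measure.2 fun a _ => (hf a).smul_measure (μ.apply_ne_top a)

variable [DiscreteMeasurableSpace S]

theorem integrable_of_finite_support {μ : PMF S} (hμ : μ.support.Finite) (f : S → ℝ) :
    Integrable f μ.toMeasure := by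
  rw [← bind_pure μ]
  refine integrable_bind hμ fun a => ?_
  rw [toMeasure_pure]
  exact integrable_dirac (by simp)

theorem integral_bind_eq_sum {μ : PMF ι} (hμ : μ.support.Finite) {κ : ι → PMF S}
    (hκ : ∀ a, (κ a).support.Finite) (f : S → ℝ) :
    ∫ s, f s ∂(μ.bind κ).toMeasure =
      ∑ a ∈ hμ.toFinset, (μ a).toReal * ∫ s, f s ∂(κ a).toMeasure := by
  rw [toMeasure_bind_eq_sum hμ, integral_finsetSum_measure]
  · simp [integral_smul_measure]
  · exact fun a _ => (integrable_of_finite_support (hκ a) f).smul_measure (μ.apply_ne_top a)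

theorem integral_pure (a : S) (f : S → ℝ) : ∫ s, f s ∂(pure a).toMeasure = f a := by
  rw [toMeasure_pure, integral_dirac]

theorem integral_bind_fintype [Fintype ι] (μ : PMF ι) {κ : ι → PMF S}
    (hκ : ∀ a, (κ a).support.Finite) (f : S → ℝ) :
    ∫ s, f s ∂(μ.bind κ).toMeasure = ∑ a, (μ a).toReal * ∫ s, f s ∂(κ a).toMeasure := by
  rw [integral_bind_eq_sum (Set.toFinite _) hκ]
  refine Finset.sum_subset (Finset.subset_univ _) fun a _ ha => ?_
  have : μ a = 0 := by simpa using ha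
  simp [this]

theorem integral_eq_sum_support {μ : PMF S} (hμ : μ.support.Finite) (f : S → ℝ) :
    ∫ s, f s ∂μ.toMeasure = ∑ a ∈ hμ.toFinset, (μ a).toReal * f a := by
  conv_lhs => rw [← bind_pure μ]
  rw [integral_bind_eq_sum hμ (fun a => by simp)]
  simp only [integral_pure]

theorem integral_bind_of_finite {μ : PMF S} (hμ : μ.support.Finite) {T : Type*}
    [MeasurableSpace T] [DiscreteMeasurableSpace T] {κ : S → PMF T}
    (hκ : ∀ a, (κ a).support.Finite) (f : T → ℝ) :
    ∫ s, f s ∂(μ.bind κ).toMeasure = ∫ a, ∫ s, f s ∂(κ a).toMeasure ∂μ.toMeasure := by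
  rw [integral_bind_eq_sum hμ hκ, integral_eq_sum_support hμ]

theorem integral_mono_on_support {μ : PMF S} (hμ : μ.support.Finite) {f g : S → ℝ}
    (h : ∀ s ∈ μ.support, f s ≤ g s) : ∫ s, f s ∂μ.toMeasure ≤ ∫ s, g s ∂μ.toMeasure :=
  integral_mono_ae (integrable_of_finite_support hμ f) (integrable_of_finite_support hμ g)
    ((μ.ae_mem_support hμ).mono h)

theorem integral_congr_on_support {μ : PMF S} (hμ : μ.support.Finite) {f g : S → ℝ}
    (h : ∀ s ∈ μ.support, f s = g s) : ∫ s, f s ∂μ.toMeasure = ∫ s, g s ∂μ.toMeasure :=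
  integral_congr_ae ((μ.ae_mem_support hμ).mono h)

theorem integral_const_add [Finite S] (μ : PMF S) (f : S → ℝ) (c : ℝ) :
    ∫ a, (c + f a) ∂μ.toMeasure = c + ∫ a, f a ∂μ.toMeasure := by
  rw [integral_add (integrable_const _) .of_finite]
  simp

/-- Chebyshev's inequality. -/
theorem toMeasure_abs_ge_le {μ : PMF S} (hμ : μ.support.Finite) (f : S → ℝ) {r V : ℝ}
    (hr : 0 < r) (hV : ∫ s, f s ^ 2 ∂μ.toMeasure ≤ V) :
    μ.toMeasure {s | r ≤ |f s|} ≤ ENNReal.ofReal (V / r ^ 2) := by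
  have h := mul_meas_ge_le_integral_of_nonneg (μ := μ.toMeasure) (f := fun s => f s ^ 2)
    (Eventually.of_forall fun s => sq_nonneg _) (integrable_of_finite_support hμ _) (r ^ 2)
  have hset : {s | r ^ 2 ≤ f s ^ 2} = {s | r ≤ |f s|} := by
    ext s
    simp only [Set.mem_ofPred_eq]
    rw [sq_le_sq, abs_of_pos hr]
  rw [hset] at h
  rw [← ofReal_measureReal (by finiteness)]
  refine ENNReal.ofReal_le_ofReal ?_
  rw [le_div_iff₀ (by positivity), mul_comm]
  exact h.trans hV

end PMF

/-! ### Degree counts of preferential attachment chains -/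

/-- The sequence `f` delayed by one step, with value `0` at `0`. -/
def lag (f : ℕ → ℝ) : ℕ → ℝ
  | 0 => 0
  | i + 1 => f i

theorem lag_sub (f g : ℕ → ℝ) (i : ℕ) : lag (fun j => f j - g j) i = lag f i - lag g i := by
  cases i <;> simp [lag]

theorem lag_mul (r : ℝ) (f : ℕ → ℝ) (i : ℕ) : lag (fun j => r * f j) i = r * lag f i := by
  cases i <;> simp [lag]

theorem lag_add (f g : ℕ → ℝ) (i : ℕ) : lag (fun j => f j + g j) i = lag f i + lag g i := by
  cases i <;> simp [lag]

/-- The parameters of a preferential attachment mechanism for a single kind of degree. A time step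
gives a new unit of degree to an old vertex, chosen with probability proportional to its degree
(probability `p`) or to its degree plus `δ` (probability `q`), and adds a vertex of degree `0`
(probability `a₀`) or of degree `1` (probability `a₁`). -/
structure AttachmentParams where
  p : ℝ
  q : ℝ
  a₀ : ℝ
  a₁ : ℝ
  δ : ℝ
  p_nonneg : 0 ≤ p
  q_nonneg : 0 ≤ q
  a₀_nonneg : 0 ≤ a₀
  a₁_nonneg : 0 ≤ a₁
  δ_nonneg : 0 ≤ δ

namespace AttachmentParams

variable (π : AttachmentParams)

/-- The expected number of new vertices of degree `i` in a time step. -/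
def source (i : ℕ) : ℝ := if i = 0 then π.a₀ else if i = 1 then π.a₁ else 0

/-- The expected number of new vertices in a time step. -/
noncomputable def γ : ℝ := π.a₀ + π.a₁

/-- The limiting value of `q` times the number of edges divided by the total weight of the vertices
when these are weighted by degree plus `δ`. -/
noncomputable def c : ℝ := π.q / (1 + π.γ * π.δ)

/-- The rate at which, per unit of logarithmic time, a vertex of degree `i` gains a unit. -/
noncomputable def rate (i : ℕ) : ℝ := (π.p + π.c) * i + π.c * π.δ

/-- The limiting proportion, relative to the number of edges, of the vertices of degree `i`. -/
noncomputable def density : ℕ → ℝ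
  | 0 => π.source 0 / (1 + π.rate 0)
  | i + 1 => (π.rate i * density i + π.source (i + 1)) / (1 + π.rate (i + 1))

theorem γ_nonneg : 0 ≤ π.γ := add_nonneg π.a₀_nonneg π.a₁_nonneg

theorem one_add_pos : 0 < 1 + π.γ * π.δ := by
  have := mul_nonneg π.γ_nonneg π.δ_nonneg
  linarith

theorem c_nonneg : 0 ≤ π.c := div_nonneg π.q_nonneg π.one_add_pos.le

theorem rate_nonneg (i : ℕ) : 0 ≤ π.rate i := by
  have := π.p_nonneg
  have := π.c_nonneg
  have := π.δ_nonneg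
  unfold rate
  positivity

theorem source_eq (i : ℕ) :
    π.source i = π.a₀ * (if i = 0 then 1 else 0) + π.a₁ * if i = 1 then 1 else 0 := by
  unfold source
  by_cases h0 : i = 0
  · simp [h0]
  · simp [h0]

theorem source_nonneg (i : ℕ) : 0 ≤ π.source i := by
  unfold source
  split_ifs
  exacts [π.a₀_nonneg, π.a₁_nonneg, le_rfl]

theorem density_nonneg (i : ℕ) : 0 ≤ π.density i := by
  induction i with
  | zero => exact div_nonneg (π.source_nonneg 0) (by linarith [π.rate_nonneg 0])
  | succ i ih =>
    exact div_nonneg (add_nonneg (mul_nonneg (π.rate_nonneg i) ih) (π.source_nonneg _))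
      (by linarith [π.rate_nonneg (i + 1)])

/-- The stationarity equation: the densities are the equilibrium of the mean flow. -/
theorem source_sub_density (i : ℕ) :
    π.source i - π.density i =
      π.rate i * π.density i - lag (fun j => π.rate j * π.density j) i := by
  have h := π.rate_nonneg i
  cases i with
  | zero =>
    rw [density, lag]
    field_simp
    ring
  | succ i =>
    rw [density, lag]
    field_simp
    ring

end AttachmentParams

/-- A Markov kernel `κ` on states `s` carrying `edges s` edges and `size s` vertices, of which
`count i s` have degree `i`, such that the mean changes in a time step are those of the mechanism
`π`. -/
structure IsAttachmentKernel {S : Type*} [MeasurableSpace S] (π : AttachmentParams)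
    (κ : S → PMF S) (edges size : S → ℕ) (count : ℕ → S → ℕ) : Prop where
  finite_support : ∀ s, (κ s).support.Finite
  edges_pos : ∀ s, 0 < edges s
  edges_succ : ∀ s, ∀ s' ∈ (κ s).support, edges s' = edges s + 1
  count_le : ∀ i s, count i s ≤ size s
  abs_size_sub_le : ∀ s, ∀ s' ∈ (κ s).support, |(size s' : ℝ) - size s| ≤ 1
  abs_count_sub_le : ∀ i s, ∀ s' ∈ (κ s).support, |(count i s' : ℝ) - count i s| ≤ 2
  mean_size : ∀ s, ∫ s', (size s' : ℝ) ∂(κ s).toMeasure = size s + π.γ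
  mean_count : ∀ i s, ∫ s', (count i s' : ℝ) ∂(κ s).toMeasure = count i s
    + π.p / edges s * (lag (fun j => (j : ℝ) * count j s) i - i * count i s)
    + π.q / (edges s + π.δ * size s) *
      (lag (fun j => ((j : ℝ) + π.δ) * count j s) i - (i + π.δ) * count i s)
    + π.source i

/-- A sequence growing at rate at most `1 / (2 m)`, `m` being the time, up to a bounded forcing, is
of linear growth. -/
theorem linear_bound_of_recursion {u : ℕ → ℝ} {m₀ : ℕ} (hm₀ : 0 < m₀) {L : ℝ}
    (h : ∀ t : ℕ, u (t + 1) ≤ u t * (1 + 1 / (2 * ((m₀ : ℝ) + t))) + L) :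
    ∃ M : ℝ, 0 ≤ M ∧ ∀ t : ℕ, u t ≤ M * (m₀ + t) := by
  have hm : (1 : ℝ) ≤ m₀ := by exact_mod_cast hm₀
  -- `M` dominates the initial value, and `M / 2` dominates the forcing.
  refine ⟨max (|u 0|) (2 * |L|), by positivity, fun t => ?_⟩
  have h1 := le_max_left (|u 0|) (2 * |L|)
  have h2 := le_max_right (|u 0|) (2 * |L|)
  have hM : 0 ≤ max (|u 0|) (2 * |L|) := by positivity
  generalize max (|u 0|) (2 * |L|) = M at *
  induction t with
  | zero =>
    have := le_abs_self (u 0)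
    have := mul_le_mul_of_nonneg_left hm hM
    push_cast
    linarith
  | succ t ih =>
    have hpos : (0 : ℝ) < m₀ + t := by positivity
    have h3 := mul_le_mul_of_nonneg_right ih (by positivity : 0 ≤ 1 + 1 / (2 * ((m₀ : ℝ) + t)))
    have h4 : M * ((m₀ : ℝ) + t) * (1 + 1 / (2 * ((m₀ : ℝ) + t))) = M * (m₀ + t) + M / 2 := by
      field_simp
    have := le_abs_self L
    have := h t
    push_cast
    linarith

namespace IsAttachmentKernel

variable {S : Type*} [MeasurableSpace S] {π : AttachmentParams}
  {κ : S → PMF S} {edges size : S → ℕ} {count : ℕ → S → ℕ}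

/-- The deviation of the number of vertices of degree `i` from its limiting proportion. -/
noncomputable def countDev (π : AttachmentParams) (edges : S → ℕ) (count : ℕ → S → ℕ) (i : ℕ)
    (s : S) : ℝ :=
  count i s - π.density i * edges s

/-- The deviation of the number of vertices from its limiting proportion. -/
noncomputable def sizeDev (π : AttachmentParams) (edges size : S → ℕ) (s : S) : ℝ :=
  size s - π.γ * edges s

/-- The part of the mean drift of `countDev` due to the fluctuation of the number of vertices. -/
noncomputable def driftError (π : AttachmentParams) (edges size : S → ℕ) (count : ℕ → S → ℕ)
    (i : ℕ) (s : S) : ℝ :=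
  (π.q / (edges s + π.δ * size s) - π.c / edges s) *
    (lag (fun j => ((j : ℝ) + π.δ) * count j s) i - (i + π.δ) * count i s)

section

variable (H : IsAttachmentKernel π κ edges size count)
include H

theorem edges_pos_real (s : S) : (0 : ℝ) < edges s := by exact_mod_cast H.edges_pos s

theorem abs_driftError_le (i : ℕ) (s : S) :
    |driftError π edges size count i s| ≤
      π.c * (i + π.δ) * |sizeDev π edges size s| / edges s := by
  have hm := H.edges_pos_real s
  have hδ := π.δ_nonneg
  have hc := π.c_nonneg
  have h1 := π.one_add_pos
  have hn : (0 : ℝ) ≤ size s := by positivity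
  have hW : 0 < (edges s : ℝ) + π.δ * size s := by positivity
  have hfac : π.q / (edges s + π.δ * size s) - π.c / edges s =
      -(π.c / edges s * (π.δ / (edges s + π.δ * size s)) * sizeDev π edges size s) := by
    have hq : π.q = π.c * (1 + π.γ * π.δ) := by
      unfold AttachmentParams.c
      field_simp
    rw [hq, sizeDev]
    field_simp
    ring
  have hN (j : ℕ) : (count j s : ℝ) ≤ size s := by exact_mod_cast H.count_le j s
  have hflow : |lag (fun j => ((j : ℝ) + π.δ) * count j s) i - (i + π.δ) * count i s| ≤
      (i + π.δ) * size s := by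
    have h2 : 0 ≤ ((i : ℝ) + π.δ) * count i s := by positivity
    have h3 : ((i : ℝ) + π.δ) * count i s ≤ (i + π.δ) * size s :=
      mul_le_mul_of_nonneg_left (hN i) (by positivity)
    have h4 : 0 ≤ lag (fun j => ((j : ℝ) + π.δ) * count j s) i ∧
        lag (fun j => ((j : ℝ) + π.δ) * count j s) i ≤ (i + π.δ) * size s := by
      cases i with
      | zero => exact ⟨le_rfl, by simp only [lag]; positivity⟩
      | succ i =>
        refine ⟨by simp only [lag]; positivity, ?_⟩
        simp only [lag]
        refine mul_le_mul ?_ (hN i) (by positivity) (by positivity)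
        push_cast
        linarith
    rw [abs_le]
    constructor <;> linarith [h4.1, h4.2]
  rw [driftError, hfac, abs_mul, abs_neg, abs_mul, abs_of_nonneg (by positivity)]
  calc _ ≤ π.c / edges s * (π.δ / (edges s + π.δ * size s)) * |sizeDev π edges size s| *
        ((i + π.δ) * size s) := mul_le_mul_of_nonneg_left hflow (by positivity)
    _ = π.c * (i + π.δ) * |sizeDev π edges size s| / edges s *
        (π.δ * size s / (edges s + π.δ * size s)) := by ring
    _ ≤ π.c * (i + π.δ) * |sizeDev π edges size s| / edges s * 1 := by
      refine mul_le_mul_of_nonneg_left ?_ (by positivity)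
      rw [div_le_one hW]
      linarith
    _ = _ := mul_one _

variable [DiscreteMeasurableSpace S]

/-- The mean drift of the deviation of a count is linear restoring, up to the deviation of the
preceding count and the fluctuation of the number of vertices. -/
theorem mean_countDev (i : ℕ) (s : S) :
    ∫ s', (countDev π edges count i s' - countDev π edges count i s) ∂(κ s).toMeasure =
      (lag (fun j => π.rate j * countDev π edges count j s) i
        - π.rate i * countDev π edges count i s) / edges s
      + driftError π edges size count i s := by
  have hm := H.edges_pos_real s
  have h1 : ∫ s', (countDev π edges count i s' - countDev π edges count i s) ∂(κ s).toMeasure =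
      ∫ s', ((count i s' : ℝ) - (count i s + π.density i)) ∂(κ s).toMeasure := by
    refine PMF.integral_congr_on_support (H.finite_support s) fun s' hs' => ?_
    rw [countDev, countDev, H.edges_succ s s' hs']
    push_cast
    ring
  rw [h1, integral_sub (PMF.integrable_of_finite_support (H.finite_support s) _)
    (integrable_const _), H.mean_count]
  have h2 := π.source_sub_density i
  simp only [integral_const, probReal_univ, one_smul]
  have h3 : lag (fun j => π.rate j * countDev π edges count j s) i =
      (π.p * lag (fun j => (j : ℝ) * count j s) i +
        π.c * lag (fun j => ((j : ℝ) + π.δ) * count j s) i)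
        - edges s * lag (fun j => π.rate j * π.density j) i := by
    rw [← lag_mul, ← lag_mul, ← lag_mul, ← lag_add, ← lag_sub]
    congr 1
    ext j
    rw [countDev, AttachmentParams.rate]
    ring
  rw [h3, driftError, countDev]
  have h4 : π.source i = π.density i + (π.rate i * π.density i
      - lag (fun j => π.rate j * π.density j) i) := by linarith
  rw [h4]
  generalize lag (fun j => π.rate j * π.density j) i = X
  generalize lag (fun j => ((j : ℝ) + π.δ) * count j s) i = Y
  generalize lag (fun j => (j : ℝ) * count j s) i = Z
  generalize π.q / (edges s + π.δ * size s) = Q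
  rw [AttachmentParams.rate]
  field_simp
  ring

omit H in
/-- Expansion of a square along a kernel step with bounded increments. -/
theorem integral_sq_le {s : S} (hs : (κ s).support.Finite) (f : S → ℝ) {K : ℝ}
    (hK : ∀ s' ∈ (κ s).support, |f s' - f s| ≤ K) :
    ∫ s', f s' ^ 2 ∂(κ s).toMeasure ≤
      f s ^ 2 + 2 * f s * ∫ s', (f s' - f s) ∂(κ s).toMeasure + K ^ 2 := by
  calc ∫ s', f s' ^ 2 ∂(κ s).toMeasure
      ≤ ∫ s', (2 * f s * (f s' - f s) + (f s ^ 2 + K ^ 2)) ∂(κ s).toMeasure := by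
        refine PMF.integral_mono_on_support hs fun s' hs' => ?_
        have := sq_le_sq' (abs_le.1 (hK s' hs')).1 (abs_le.1 (hK s' hs')).2
        linarith [sq_nonneg (f s' - f s)]
    _ = _ := by
        rw [integral_add (PMF.integrable_of_finite_support hs _) (integrable_const _),
          integral_const_mul]
        simp
        ring

theorem step_sizeDev_sq_le (s : S) :
    ∫ s', sizeDev π edges size s' ^ 2 ∂(κ s).toMeasure ≤
      sizeDev π edges size s ^ 2 + (1 + π.γ) ^ 2 := by
  have hγ := π.γ_nonneg
  have hs := H.finite_support s
  have hdiff : ∀ s' ∈ (κ s).support, sizeDev π edges size s' - sizeDev π edges size s =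
      size s' - size s - π.γ := fun s' hs' => by
    rw [sizeDev, sizeDev, H.edges_succ s s' hs']
    push_cast
    ring
  have h := integral_sq_le hs (sizeDev π edges size) (K := 1 + π.γ) fun s' hs' => by
    rw [hdiff s' hs']
    have := abs_le.1 (H.abs_size_sub_le s s' hs')
    rw [abs_le]
    constructor <;> linarith [this.1, this.2]
  have hmean : ∫ s', (sizeDev π edges size s' - sizeDev π edges size s) ∂(κ s).toMeasure = 0 := by
    rw [PMF.integral_congr_on_support hs hdiff]
    simp only [sub_sub]
    rw [integral_sub (PMF.integrable_of_finite_support hs _) (integrable_const _), H.mean_size]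
    simp
  rw [hmean] at h
  linarith

/-- The one-step estimate behind the second moment bound. The restoring part of the drift is dropped
by its sign, and the rest is absorbed into a rate of growth `1 / (2 m)`. -/
theorem step_countDev_sq_le (i : ℕ) (s : S) :
    ∫ s', countDev π edges count i s' ^ 2 ∂(κ s).toMeasure ≤
      countDev π edges count i s ^ 2 * (1 + 1 / (2 * edges s))
      + 4 * ((lag (fun j => π.rate j * countDev π edges count j s) i) ^ 2 +
        (π.c * (i + π.δ)) ^ 2 * sizeDev π edges size s ^ 2) / edges s
      + (2 + π.density i) ^ 2 := by
  have hm := H.edges_pos_real s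
  have hx := π.density_nonneg i
  have h := integral_sq_le (H.finite_support s) (countDev π edges count i) (K := 2 + π.density i)
    fun s' hs' => by
      have := abs_le.1 (H.abs_count_sub_le i s s' hs')
      rw [countDev, countDev, H.edges_succ s s' hs', abs_le]
      push_cast
      constructor <;> linarith [this.1, this.2]
  rw [H.mean_countDev] at h
  have hR := H.abs_driftError_le i s
  have ha := π.rate_nonneg i
  generalize countDev π edges count i s = D at *
  generalize lag (fun j => π.rate j * countDev π edges count j s) i = Y at *
  generalize driftError π edges size count i s = R at *
  generalize sizeDev π edges size s = E at *
  refine h.trans ?_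
  have h1 : 2 * D * ((Y - π.rate i * D) / edges s + R) ≤
      (D ^ 2 / 2 + 4 * (Y ^ 2 + (π.c * (i + π.δ)) ^ 2 * E ^ 2)) / edges s := by
    rw [le_div_iff₀ hm]
    have h2 : |R * edges s| ≤ π.c * (i + π.δ) * |E| := by
      rw [abs_mul, abs_of_pos hm]
      exact (le_div_iff₀ hm).1 hR
    have h3 : (R * edges s) ^ 2 ≤ (π.c * (i + π.δ)) ^ 2 * E ^ 2 := by
      rw [← sq_abs (R * edges s), ← sq_abs E, ← mul_pow]
      exact pow_le_pow_left₀ (abs_nonneg _) h2 2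
    have h4 : 2 * D * ((Y - π.rate i * D) / edges s + R) * edges s =
        2 * D * Y + 2 * D * (R * edges s) - 2 * (π.rate i * D ^ 2) := by
      field_simp
      ring
    rw [h4]
    have := mul_nonneg ha (sq_nonneg D)
    linarith [sq_nonneg (D / 2 - 2 * Y), sq_nonneg (D / 2 - 2 * (R * edges s))]
  have h5 : (D ^ 2 / 2 + 4 * (Y ^ 2 + (π.c * (i + π.δ)) ^ 2 * E ^ 2)) / edges s =
      D ^ 2 * (1 / (2 * edges s)) +
        4 * (Y ^ 2 + (π.c * (i + π.δ)) ^ 2 * E ^ 2) / edges s := by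
    field_simp
  linarith

end

end IsAttachmentKernel

/-! ### Laws of large numbers for the counts -/

namespace IsAttachmentKernel

variable {S : Type*} [MeasurableSpace S] [DiscreteMeasurableSpace S] {π : AttachmentParams}
  {κ : S → PMF S} {edges size : S → ℕ} {count : ℕ → S → ℕ}
  (H : IsAttachmentKernel π κ edges size count)
  {μ : ℕ → PMF S} {s₀ : S} (h₀ : μ 0 = PMF.pure s₀) (hμ : ∀ t, μ (t + 1) = (μ t).bind κ)
include H h₀ hμ

omit [DiscreteMeasurableSpace S] in
theorem law_support_finite (t : ℕ) : (μ t).support.Finite := by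
  induction t with
  | zero => simp [h₀]
  | succ t ih =>
    rw [hμ]
    exact PMF.support_bind_finite ih H.finite_support

omit [DiscreteMeasurableSpace S] in
theorem edges_eq (t : ℕ) : ∀ s ∈ (μ t).support, edges s = edges s₀ + t := by
  induction t with
  | zero => simp [h₀]
  | succ t ih =>
    intro s hs
    rw [hμ, PMF.mem_support_bind_iff] at hs
    obtain ⟨s', hs', hs⟩ := hs
    rw [H.edges_succ s' s hs, ih s' hs', add_assoc]

theorem integral_law_succ (f : S → ℝ) (t : ℕ) :
    ∫ s, f s ∂(μ (t + 1)).toMeasure = ∫ s, ∫ s', f s' ∂(κ s).toMeasure ∂(μ t).toMeasure := by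
  rw [hμ, PMF.integral_bind_of_finite (H.law_support_finite h₀ hμ t) H.finite_support]

theorem sizeDev_sq_le : ∃ M : ℝ, 0 ≤ M ∧ ∀ t : ℕ,
    ∫ s, sizeDev π edges size s ^ 2 ∂(μ t).toMeasure ≤ M * (edges s₀ + t) := by
  refine linear_bound_of_recursion (H.edges_pos s₀) (L := (1 + π.γ) ^ 2) fun t => ?_
  have hfin := H.law_support_finite h₀ hμ t
  rw [H.integral_law_succ h₀ hμ]
  refine (PMF.integral_mono_on_support hfin fun s _ => H.step_sizeDev_sq_le s).trans ?_
  rw [integral_add (PMF.integrable_of_finite_support hfin _) (integrable_const _)]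
  simp only [integral_const, probReal_univ, one_smul]
  have : 0 ≤ ∫ s, sizeDev π edges size s ^ 2 ∂(μ t).toMeasure :=
    integral_nonneg fun s => sq_nonneg _
  have h2 : 0 ≤ 1 / (2 * ((edges s₀ : ℝ) + t)) := by positivity
  linarith [mul_nonneg this h2]

theorem countDev_sq_le_of_lag {i : ℕ} {M : ℝ}
    (hlag : ∀ t : ℕ, ∫ s, lag (fun j => π.rate j * countDev π edges count j s) i ^ 2
      ∂(μ t).toMeasure ≤ M * (edges s₀ + t)) :
    ∃ M' : ℝ, 0 ≤ M' ∧ ∀ t : ℕ,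
      ∫ s, countDev π edges count i s ^ 2 ∂(μ t).toMeasure ≤ M' * (edges s₀ + t) := by
  obtain ⟨M₁, -, hM₁⟩ := H.sizeDev_sq_le h₀ hμ
  refine linear_bound_of_recursion (H.edges_pos s₀)
    (L := 4 * (M + (π.c * (i + π.δ)) ^ 2 * M₁) + (2 + π.density i) ^ 2) fun t => ?_
  have hfin := H.law_support_finite h₀ hμ t
  have hpos : (0 : ℝ) < edges s₀ + t := by
    have := H.edges_pos_real s₀
    positivity
  have hI (f : S → ℝ) := PMF.integrable_of_finite_support hfin f
  rw [H.integral_law_succ h₀ hμ]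
  have hstep : ∀ s ∈ (μ t).support, ∫ s', countDev π edges count i s' ^ 2 ∂(κ s).toMeasure ≤
      (1 + 1 / (2 * ((edges s₀ : ℝ) + t))) * countDev π edges count i s ^ 2
      + (4 / ((edges s₀ : ℝ) + t) *
          lag (fun j => π.rate j * countDev π edges count j s) i ^ 2
        + (4 * (π.c * (i + π.δ)) ^ 2 / ((edges s₀ : ℝ) + t) * sizeDev π edges size s ^ 2
          + (2 + π.density i) ^ 2)) := fun s hs => by
    refine (H.step_countDev_sq_le i s).trans (le_of_eq ?_)
    rw [H.edges_eq h₀ hμ t s hs]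
    push_cast
    ring
  refine (PMF.integral_mono_on_support hfin hstep).trans ?_
  rw [integral_add (hI _) (hI _), integral_add (hI _) (hI _), integral_add (hI _) (hI _),
    integral_const_mul, integral_const_mul, integral_const_mul]
  simp only [integral_const, probReal_univ, one_smul]
  have h1 := mul_le_mul_of_nonneg_left (hlag t)
    (by positivity : 0 ≤ 4 / ((edges s₀ : ℝ) + t))
  have h2 := mul_le_mul_of_nonneg_left (hM₁ t)
    (by positivity : 0 ≤ 4 * (π.c * (i + π.δ)) ^ 2 / ((edges s₀ : ℝ) + t))
  have h3 : 4 / ((edges s₀ : ℝ) + t) * (M * (edges s₀ + t)) = 4 * M := by field_simp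
  have h4 : 4 * (π.c * (i + π.δ)) ^ 2 / ((edges s₀ : ℝ) + t) * (M₁ * (edges s₀ + t)) =
      4 * (π.c * (i + π.δ)) ^ 2 * M₁ := by field_simp
  linarith

theorem countDev_sq_le (i : ℕ) : ∃ M : ℝ, 0 ≤ M ∧ ∀ t : ℕ,
    ∫ s, countDev π edges count i s ^ 2 ∂(μ t).toMeasure ≤ M * (edges s₀ + t) := by
  induction i with
  | zero => exact H.countDev_sq_le_of_lag h₀ hμ (M := 0) (by simp [lag])
  | succ i ih =>
    obtain ⟨M, -, hM⟩ := ih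
    refine H.countDev_sq_le_of_lag h₀ hμ (M := π.rate i ^ 2 * M) fun t => ?_
    simp only [lag, mul_pow]
    rw [integral_const_mul, mul_assoc]
    exact mul_le_mul_of_nonneg_left (hM t) (sq_nonneg _)

/-- A statistic with second moment of linear growth is negligible at linear scale. -/
theorem tendsto_measure_of_sq_le {f : S → ℝ} {M : ℝ}
    (hM : ∀ t : ℕ, ∫ s, f s ^ 2 ∂(μ t).toMeasure ≤ M * (edges s₀ + t)) {r : ℝ} (hr : 0 < r) :
    Tendsto (fun t : ℕ => (μ t).toMeasure {s | r * (edges s₀ + t) ≤ |f s|}) atTop (𝓝 0) := by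
  have hm := H.edges_pos_real s₀
  have hlim : Tendsto (fun t : ℕ => ENNReal.ofReal (M / r ^ 2 / (edges s₀ + t))) atTop (𝓝 0) := by
    rw [← ENNReal.ofReal_zero]
    refine ENNReal.tendsto_ofReal (Tendsto.div_atTop tendsto_const_nhds ?_)
    exact tendsto_atTop_add_const_left _ _ tendsto_natCast_atTop_atTop
  refine tendsto_of_tendsto_of_tendsto_of_le_of_le tendsto_const_nhds hlim
    (fun _ => zero_le) fun t => ?_
  have hpos : (0 : ℝ) < edges s₀ + t := by positivity
  refine (PMF.toMeasure_abs_ge_le (H.law_support_finite h₀ hμ t) f (mul_pos hr hpos)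
    (hM t)).trans (ENNReal.ofReal_le_ofReal (le_of_eq ?_))
  field_simp

theorem tendstoInProb_count_div_size (hγ : 0 < π.γ) (i : ℕ) :
    TendstoInProb μ (fun _ s => (count i s : ℝ) / size s) (π.density i / π.γ) := by
  intro ε hε
  obtain ⟨M, -, hM⟩ := H.countDev_sq_le h₀ hμ i
  obtain ⟨M', -, hM'⟩ := H.sizeDev_sq_le h₀ hμ
  have hx : 0 ≤ π.density i / π.γ := div_nonneg (π.density_nonneg i) hγ.le
  set P := π.density i / π.γ with hP
  have hxP : π.density i = P * π.γ := by rw [hP]; field_simp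
  -- If both deviations are below `r m`, then `size ≥ (γ / 2) m`, and the error is below `ε`.
  set r := min (π.γ / 2) (ε * π.γ / (2 * (1 + P))) with hr
  have hr0 : 0 < r := by positivity
  have hr1 : r ≤ π.γ / 2 := min_le_left _ _
  have hr2 : r * (1 + P) ≤ ε * (π.γ / 2) := by
    calc r * (1 + P) ≤ ε * π.γ / (2 * (1 + P)) * (1 + P) :=
          mul_le_mul_of_nonneg_right (min_le_right _ _) (by positivity)
      _ = _ := by field_simp
  have hlim := (H.tendsto_measure_of_sq_le h₀ hμ hM hr0).add
    (H.tendsto_measure_of_sq_le h₀ hμ hM' hr0)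
  rw [add_zero] at hlim
  refine tendsto_of_tendsto_of_tendsto_of_le_of_le tendsto_const_nhds hlim
    (fun _ => zero_le) fun t => ?_
  refine (measure_mono_ae ?_).trans (measure_union_le _ _)
  filter_upwards [PMF.ae_mem_support _ (H.law_support_finite h₀ hμ t)] with s hs hε'
  have hms := H.edges_eq h₀ hμ t s hs
  have hm := H.edges_pos_real s
  have hcast : (edges s : ℝ) = edges s₀ + t := by rw [hms]; push_cast; rfl
  change ε ≤ |(count i s : ℝ) / size s - P| at hε'
  change r * (edges s₀ + t) ≤ |countDev π edges count i s| ∨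
    r * (edges s₀ + t) ≤ |sizeDev π edges size s|
  rw [← hcast]
  by_contra! hcon
  obtain ⟨hD, hE⟩ := hcon
  have hsize : π.γ / 2 * edges s < size s := by
    have := (abs_lt.1 hE).1
    rw [sizeDev] at this
    have := mul_le_mul_of_nonneg_right hr1 hm.le
    linarith
  have hn : (0 : ℝ) < size s := lt_of_le_of_lt (by positivity) hsize
  have heq : (count i s : ℝ) / size s - P =
      (countDev π edges count i s - P * sizeDev π edges size s) / size s := by
    rw [countDev, sizeDev, hxP]
    field_simp
    ring
  rw [heq, abs_div, abs_of_pos hn, le_div_iff₀ hn] at hε'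
  have h1 : |countDev π edges count i s - P * sizeDev π edges size s| <
      r * edges s + P * (r * edges s) := by
    refine (abs_sub _ _).trans_lt ?_
    rw [abs_mul, abs_of_nonneg hx]
    exact add_lt_add_of_lt_of_le hD (mul_le_mul_of_nonneg_left hE.le hx)
  have h2 := mul_le_mul_of_nonneg_right hr2 hm.le
  have h3 := mul_lt_mul_of_pos_left hsize hε
  linarith

theorem tendstoInProb_count_div_time (i : ℕ) :
    TendstoInProb μ (fun t s => (count i s : ℝ) / (t : ℝ)) (π.density i) := by
  intro ε hε
  obtain ⟨M, -, hM⟩ := H.countDev_sq_le h₀ hμ i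
  have hlim := H.tendsto_measure_of_sq_le h₀ hμ hM (by positivity : 0 < ε / 4)
  refine tendsto_of_tendsto_of_tendsto_of_le_of_le' tendsto_const_nhds hlim
    (Eventually.of_forall fun _ => zero_le) ?_
  have hx := π.density_nonneg i
  -- For large `t` the contribution `density i * edges s₀` of the initial edges is at most
  -- `(ε / 2) t`, and the initial number of edges is at most `t`.
  filter_upwards [eventually_ge_atTop (max 1 (max (edges s₀)
    ⌈π.density i * edges s₀ / (ε / 2)⌉₊))] with t ht
  have ht1 : (1 : ℝ) ≤ t := by exact_mod_cast (le_max_left _ _).trans ht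
  have ht2 : (edges s₀ : ℝ) ≤ t := by
    exact_mod_cast (le_max_left _ _).trans ((le_max_right _ _).trans ht)
  have ht3 : π.density i * edges s₀ ≤ t * (ε / 2) := by
    have := (Nat.le_ceil _).trans (Nat.cast_le (α := ℝ).2
      ((le_max_right _ _).trans ((le_max_right _ _).trans ht)))
    rwa [div_le_iff₀ (by positivity)] at this
  refine measure_mono_ae ?_
  filter_upwards [PMF.ae_mem_support _ (H.law_support_finite h₀ hμ t)] with s hs hε'
  have hms := H.edges_eq h₀ hμ t s hs
  change ε ≤ |(count i s : ℝ) / t - π.density i| at hε'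
  change ε / 4 * (edges s₀ + t) ≤ |countDev π edges count i s|
  have ht0 : (0 : ℝ) < t := by linarith
  have heq : (count i s : ℝ) / t - π.density i =
      (countDev π edges count i s + π.density i * edges s₀) / t := by
    rw [countDev, hms]
    push_cast
    field_simp
    ring
  rw [heq, abs_div, abs_of_pos ht0, le_div_iff₀ ht0] at hε'
  have h1 := abs_add_le (countDev π edges count i s) (π.density i * edges s₀)
  rw [abs_of_nonneg (by positivity : 0 ≤ π.density i * (edges s₀ : ℝ))] at h1
  have h2 := mul_le_mul_of_nonneg_left ht2 (by positivity : 0 ≤ ε / 4)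
  linarith

theorem tendsto_mean_count_div_time (i : ℕ) :
    Tendsto (fun t : ℕ => (∫ s, (count i s : ℝ) ∂(μ t).toMeasure) / (t : ℝ)) atTop
      (𝓝 (π.density i)) := by
  obtain ⟨M, hM0, hM⟩ := H.countDev_sq_le h₀ hμ i
  have hm := H.edges_pos_real s₀
  set m₀ : ℝ := (edges s₀ : ℝ) with hm₀
  set d : ℕ → ℝ := fun t => ∫ s, countDev π edges count i s ∂(μ t).toMeasure with hd
  have hmean (t : ℕ) : ∫ s, (count i s : ℝ) ∂(μ t).toMeasure =
      d t + π.density i * (m₀ + t) := by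
    have hfin := H.law_support_finite h₀ hμ t
    have hI (f : S → ℝ) := PMF.integrable_of_finite_support hfin f
    rw [PMF.integral_congr_on_support hfin (g := fun s => countDev π edges count i s +
      π.density i * (m₀ + t)) fun s hs => ?_]
    · rw [integral_add (hI _) (hI _)]
      simp [hd]
    · rw [countDev, H.edges_eq h₀ hμ t s hs]
      push_cast
      ring
  have hdsq (t : ℕ) : d t ^ 2 ≤ M * (m₀ + t) := by
    have hfin := H.law_support_finite h₀ hμ t
    have hI (f : S → ℝ) := PMF.integrable_of_finite_support hfin f
    have h1 : 0 ≤ ∫ s, (countDev π edges count i s - d t) ^ 2 ∂(μ t).toMeasure :=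
      integral_nonneg fun s => sq_nonneg _
    have h2 : ∫ s, (countDev π edges count i s - d t) ^ 2 ∂(μ t).toMeasure =
        (∫ s, countDev π edges count i s ^ 2 ∂(μ t).toMeasure) - d t ^ 2 := by
      have : ∀ s, (countDev π edges count i s - d t) ^ 2 =
          countDev π edges count i s ^ 2 - ((2 * d t) * countDev π edges count i s - d t ^ 2) :=
        fun s => by ring
      simp only [this]
      rw [integral_sub (hI _) (hI _), integral_sub (hI _) (hI _), integral_const_mul]
      simp only [integral_const, probReal_univ, one_smul]
      change _ - (2 * d t * d t - _) = _
      ring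
    linarith [hM t]
  have hdlim : Tendsto (fun t : ℕ => d t / (t : ℝ)) atTop (𝓝 0) := by
    have hsq : Tendsto (fun t : ℕ => M * ((m₀ + 1) / (t : ℝ))) atTop (𝓝 0) := by
      simpa using (tendsto_const_div_atTop_nhds_zero_nat (m₀ + 1)).const_mul M
    have hsqrt := (Real.continuous_sqrt.tendsto 0).comp hsq
    rw [Real.sqrt_zero] at hsqrt
    refine squeeze_zero_norm' ?_ hsqrt
    filter_upwards [eventually_ge_atTop 1] with t ht
    have ht1 : (1 : ℝ) ≤ t := by exact_mod_cast ht
    have ht0 : (0 : ℝ) < t := by linarith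
    refine Real.abs_le_sqrt ?_
    rw [div_pow, div_le_iff₀ (by positivity)]
    refine (hdsq t).trans ?_
    have : M * ((m₀ + 1) / t) * (t : ℝ) ^ 2 = M * (m₀ * t + t) := by field_simp
    rw [this]
    refine mul_le_mul_of_nonneg_left ?_ hM0
    have := mul_le_mul_of_nonneg_left ht1 hm.le
    linarith
  have hlim : Tendsto (fun t : ℕ => d t / (t : ℝ) + π.density i * (m₀ / (t : ℝ) + 1)) atTop
      (𝓝 (0 + π.density i * (0 + 1))) :=
    hdlim.add (((tendsto_const_div_atTop_nhds_zero_nat m₀).add_const 1).const_mul _)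
  rw [zero_add, zero_add, mul_one] at hlim
  refine hlim.congr' ?_
  filter_upwards [eventually_ge_atTop 1] with t ht
  have ht0 : (0 : ℝ) < t := by exact_mod_cast ht
  rw [hmean]
  field_simp

end IsAttachmentKernel

/-! ### The power law of the limiting densities -/

namespace AttachmentParams

variable (π : AttachmentParams)

/-- Unrolling the recursion: the densities are a quotient of two rising factorials. -/
theorem density_add_two_eq_prod (ha : 0 < π.p + π.c) (n : ℕ) :
    π.density (n + 2) = π.density 1 *
      ((∏ j ∈ Finset.range (n + 1), (1 + π.c * π.δ / (π.p + π.c) + (j : ℝ))) /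
        ∏ j ∈ Finset.range (n + 1),
          (1 + π.c * π.δ / (π.p + π.c) + (1 + 1 / (π.p + π.c)) + (j : ℝ))) := by
  have hb : 0 ≤ π.c * π.δ / (π.p + π.c) :=
    div_nonneg (mul_nonneg π.c_nonneg π.δ_nonneg) ha.le
  have hstep (i : ℕ) : π.density (i + 2) = π.density (i + 1) *
      ((1 + π.c * π.δ / (π.p + π.c) + (i : ℝ)) /
        (1 + π.c * π.δ / (π.p + π.c) + (1 + 1 / (π.p + π.c)) + (i : ℝ))) := by
    have h1 := π.rate_nonneg (i + 2)
    have h2 : π.rate (i + 1) = (π.p + π.c) * (1 + π.c * π.δ / (π.p + π.c) + (i : ℝ)) := by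
      rw [rate]
      push_cast
      field_simp
      ring
    have h3 : 1 + π.rate (i + 2) =
        (π.p + π.c) * (1 + π.c * π.δ / (π.p + π.c) + (1 + 1 / (π.p + π.c)) + (i : ℝ)) := by
      rw [rate]
      push_cast
      field_simp
      ring
    have h4 : π.source (i + 2) = 0 := by simp [source]
    rw [density, h4, h2, h3, add_zero, mul_assoc, mul_div_mul_left _ _ ha.ne']
    ring
  induction n with
  | zero => simpa using hstep 0
  | succ n ih =>
    rw [hstep (n + 1), ih, Finset.prod_range_succ _ (n + 1), Finset.prod_range_succ _ (n + 1),
      mul_assoc, div_mul_div_comm]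

/-- The densities decay polynomially: by Euler's limit formula for the Gamma function, a quotient of
rising factorials of base points `s` and `s + e` is asymptotic to `Γ (s + e) / Γ s * n ^ (-e)`. -/
theorem density_isEquivalent (ha : 0 < π.p + π.c) (h1 : 0 < π.density 1) :
    ∃ C : ℝ, 0 < C ∧
      π.density ~[atTop] fun i : ℕ => C * (i : ℝ) ^ (-(1 + 1 / (π.p + π.c))) := by
  have hb : 0 ≤ π.c * π.δ / (π.p + π.c) :=
    div_nonneg (mul_nonneg π.c_nonneg π.δ_nonneg) ha.le
  have hprod := π.density_add_two_eq_prod ha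
  have he : 0 < 1 + 1 / (π.p + π.c) := by positivity
  generalize 1 + 1 / (π.p + π.c) = e at *
  obtain ⟨s, hs⟩ : ∃ s, s = 1 + π.c * π.δ / (π.p + π.c) := ⟨_, rfl⟩
  simp only [← hs] at hprod
  have hs0 : 0 < s := by rw [hs]; positivity
  have hΓ := Real.Gamma_pos_of_pos hs0
  have hΓ' := Real.Gamma_pos_of_pos (add_pos hs0 he)
  have hC : 0 < π.density 1 * (Real.Gamma (s + e) / Real.Gamma s) := by positivity
  refine ⟨_, hC, ?_⟩
  have hlim : Tendsto (fun i : ℕ => π.density i * (i : ℝ) ^ e) atTop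
      (𝓝 (π.density 1 * (Real.Gamma (s + e) / Real.Gamma s))) := by
    rw [← tendsto_add_atTop_iff_nat 2]
    have hshift : Tendsto (fun n : ℕ => (1 + 2 / (n : ℝ)) ^ e) atTop (𝓝 1) := by
      have := ((tendsto_const_div_atTop_nhds_zero_nat (2 : ℝ)).const_add 1).rpow_const
        (p := e) (Or.inr he.le)
      simpa using this
    have hlim := (((Real.GammaSeq_tendsto_Gamma (s + e)).div (Real.GammaSeq_tendsto_Gamma s)
      hΓ.ne').const_mul (π.density 1)).mul hshift
    rw [mul_one] at hlim
    refine hlim.congr' ?_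
    filter_upwards [eventually_ge_atTop 1] with n hn
    have hn0 : (0 : ℝ) < n := by exact_mod_cast hn
    have hp1 : 0 < ∏ j ∈ Finset.range (n + 1), (s + (j : ℝ)) :=
      Finset.prod_pos fun j _ => by positivity
    have hp2 : 0 < ∏ j ∈ Finset.range (n + 1), (s + e + (j : ℝ)) :=
      Finset.prod_pos fun j _ => by positivity
    have hfac : (0 : ℝ) < n.factorial := by exact_mod_cast n.factorial_pos
    have hsplit : ((n + 2 : ℕ) : ℝ) = n * (1 + 2 / n) := by
      push_cast
      field_simp
    rw [hprod, hsplit, Real.mul_rpow hn0.le (by positivity), Pi.div_apply, Real.GammaSeq,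
      Real.GammaSeq, Real.rpow_add hn0]
    have := Real.rpow_pos_of_pos hn0 s
    field_simp
  have hne : ∀ᶠ i : ℕ in atTop,
      π.density 1 * (Real.Gamma (s + e) / Real.Gamma s) * (i : ℝ) ^ (-e) ≠ 0 := by
    filter_upwards [eventually_ge_atTop 1] with i hi
    have hi0 : (0 : ℝ) < i := by exact_mod_cast hi
    have := Real.rpow_pos_of_pos hi0 (-e)
    positivity
  rw [isEquivalent_iff_tendsto_one hne]
  have h2 := hlim.div_const (π.density 1 * (Real.Gamma (s + e) / Real.Gamma s))
  rw [div_self hC.ne'] at h2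
  refine h2.congr fun i => ?_
  rw [Pi.div_apply, Real.rpow_neg (Nat.cast_nonneg i)]
  simp only [div_eq_mul_inv, mul_inv, inv_inv]
  ring

/-- Vertices of degree `1` have positive density as soon as they arrive at positive rate or vertices
of degree `0` both arrive and are upgraded at positive rate. -/
theorem density_one_pos (h : 0 < π.a₀ * (π.c * π.δ) + π.a₁) : 0 < π.density 1 := by
  have h0 := π.rate_nonneg 0
  have h1 := π.rate_nonneg 1
  have hc := mul_nonneg π.c_nonneg π.δ_nonneg
  have hr : π.rate 0 = π.c * π.δ := by simp [rate]
  have hd : π.density 0 = π.a₀ / (1 + π.c * π.δ) := by simp [density, hr, source]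
  rw [density, hd, hr, show π.source (0 + 1) = π.a₁ by simp [source]]
  refine div_pos ?_ (by linarith)
  rcases π.a₁_nonneg.lt_or_eq with h2 | h2
  · have := π.a₀_nonneg
    positivity
  · rw [← h2, add_zero] at h ⊢
    have : π.c * π.δ * (π.a₀ / (1 + π.c * π.δ)) = π.a₀ * (π.c * π.δ) / (1 + π.c * π.δ) := by ring
    rw [this]
    positivity

end AttachmentParams

/-! ### Effect of the moves on the degree counts -/

namespace DiMultigraph

instance : DiscreteMeasurableSpace DiMultigraph := ⟨fun _ => trivial⟩

/-- The graph with all edges reversed. By definition it exchanges in-degrees and out-degrees, so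
that facts about in-degrees apply to out-degrees without further proof. -/
def reverse (G : DiMultigraph) : DiMultigraph where
  n := G.n
  m := G.m
  src := G.tgt
  tgt := G.src
  edge_pos := G.edge_pos

theorem inDeg_eq_sum (G : DiMultigraph) (v : Fin G.n) :
    G.inDeg v = ∑ e, if G.tgt e = v then 1 else 0 :=
  Finset.card_filter _ _

theorem inCount_eq_sum (G : DiMultigraph) (i : ℕ) :
    (G.inCount i : ℝ) = ∑ v, if G.inDeg v = i then 1 else 0 := by
  rw [inCount, Finset.card_filter]
  push_cast
  rfl

theorem sum_inDeg (G : DiMultigraph) : ∑ v, G.inDeg v = G.m := by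
  simp only [inDeg_eq_sum]
  rw [Finset.sum_comm]
  simp

theorem inCount_le (G : DiMultigraph) (i : ℕ) : G.inCount i ≤ G.n :=
  (Finset.card_filter_le _ _).trans (by simp)

theorem inDeg_addEdge (G : DiMultigraph) (u v w : Fin G.n) :
    (G.addEdge u v).inDeg w = G.inDeg w + if v = w then 1 else 0 := by
  rw [G.inDeg_eq_sum]
  refine (inDeg_eq_sum (G.addEdge u v) w).trans ((Fin.sum_univ_castSucc (n := G.m) _).trans ?_)
  simp [addEdge]

theorem inDeg_addVertex_castSucc (G : DiMultigraph) (v : Fin G.n) :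
    G.addVertex.inDeg v.castSucc = G.inDeg v := by
  rw [G.inDeg_eq_sum]
  refine (inDeg_eq_sum G.addVertex v.castSucc).trans (Finset.sum_congr rfl fun e _ => ?_)
  simp only [addVertex, Fin.castSucc_inj]

theorem inDeg_addVertex_last (G : DiMultigraph) : G.addVertex.inDeg (Fin.last G.n) = 0 := by
  refine (inDeg_eq_sum G.addVertex (Fin.last G.n)).trans ?_
  simp [addVertex]

/-- The change in the number of vertices of degree `i` when a vertex of degree `d` gains a unit. -/
def upgrade (i d : ℕ) : ℝ := (if d + 1 = i then 1 else 0) - if d = i then 1 else 0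

theorem abs_upgrade_le (i d : ℕ) : |upgrade i d| ≤ 1 := by
  unfold upgrade
  split_ifs <;> norm_num

theorem inCount_addEdge (G : DiMultigraph) (u v : Fin G.n) (i : ℕ) :
    ((G.addEdge u v).inCount i : ℝ) = G.inCount i + upgrade i (G.inDeg v) := by
  rw [G.inCount_eq_sum]
  have h (w : Fin G.n) : (if (G.addEdge u v).inDeg w = i then (1 : ℝ) else 0) =
      (if G.inDeg w = i then 1 else 0) + if v = w then upgrade i (G.inDeg v) else 0 := by
    rw [inDeg_addEdge]
    by_cases hw : v = w
    · subst hw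
      simp [upgrade]
    · simp [hw]
  calc ((G.addEdge u v).inCount i : ℝ)
      = ∑ w : Fin G.n, if (G.addEdge u v).inDeg w = i then (1 : ℝ) else 0 :=
        inCount_eq_sum (G.addEdge u v) i
    _ = _ := by
        rw [Finset.sum_congr rfl fun w _ => h w, Finset.sum_add_distrib]
        simp

theorem inCount_addVertex (G : DiMultigraph) (i : ℕ) :
    (G.addVertex.inCount i : ℝ) = G.inCount i + if i = 0 then 1 else 0 := by
  rw [G.inCount_eq_sum]
  refine (inCount_eq_sum G.addVertex i).trans ((Fin.sum_univ_castSucc (n := G.n) _).trans ?_)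
  simp only [inDeg_addVertex_castSucc, inDeg_addVertex_last, eq_comm]

theorem inCount_addSource (G : DiMultigraph) (v : Fin G.n) (i : ℕ) :
    ((G.addSource v).inCount i : ℝ) =
      G.inCount i + upgrade i (G.inDeg v) + if i = 0 then 1 else 0 := by
  refine (inCount_addEdge G.addVertex (Fin.last G.n) v.castSucc i).trans ?_
  rw [inCount_addVertex, show G.addVertex.inDeg _ = G.inDeg v from inDeg_addVertex_castSucc G v]
  ring

theorem inCount_addTarget (G : DiMultigraph) (u : Fin G.n) (i : ℕ) :
    ((G.addTarget u).inCount i : ℝ) = G.inCount i + if i = 1 then 1 else 0 := by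
  refine (inCount_addEdge G.addVertex u.castSucc (Fin.last G.n) i).trans ?_
  rw [inCount_addVertex, show G.addVertex.inDeg _ = 0 from inDeg_addVertex_last G, upgrade]
  simp only [zero_add, @eq_comm ℕ _ i]
  ring

theorem outCount_addEdge (G : DiMultigraph) (u v : Fin G.n) (i : ℕ) :
    ((G.addEdge u v).outCount i : ℝ) = G.outCount i + upgrade i (G.outDeg u) :=
  G.reverse.inCount_addEdge v u i

theorem outCount_addSource (G : DiMultigraph) (v : Fin G.n) (i : ℕ) :
    ((G.addSource v).outCount i : ℝ) = G.outCount i + if i = 1 then 1 else 0 :=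
  G.reverse.inCount_addTarget v i

theorem outCount_addTarget (G : DiMultigraph) (u : Fin G.n) (i : ℕ) :
    ((G.addTarget u).outCount i : ℝ) =
      G.outCount i + upgrade i (G.outDeg u) + if i = 0 then 1 else 0 :=
  G.reverse.inCount_addSource u i

/-! ### The random choices of a time step -/

theorem chooseByIn_apply_toReal (G : DiMultigraph) {δ : ℝ} (hδ : 0 ≤ δ) (v : Fin G.n) :
    (G.chooseByIn δ v).toReal = (G.inDeg v + δ) / (G.m + δ * G.n) := by
  have h : ∑' v : Fin G.n, ((G.inDeg v : ℝ≥0∞) + ENNReal.ofReal δ) =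
      ENNReal.ofReal (G.m + δ * G.n) := by
    rw [tsum_fintype, Finset.sum_add_distrib, ← Nat.cast_sum, sum_inDeg,
      ENNReal.ofReal_add (by positivity) (by positivity), ENNReal.ofReal_natCast]
    simp [ENNReal.ofReal_mul hδ, mul_comm]
  rw [chooseByIn, PMF.normalize_apply, h, ENNReal.toReal_mul, ENNReal.toReal_inv,
    ENNReal.toReal_ofReal (by positivity), ENNReal.toReal_add (by simp) (by simp),
    ENNReal.toReal_ofReal hδ, ENNReal.toReal_natCast, div_eq_mul_inv]

theorem integral_chooseByIn (G : DiMultigraph) {δ : ℝ} (hδ : 0 ≤ δ) (h : Fin G.n → ℝ) :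
    ∫ v, h v ∂(G.chooseByIn δ).toMeasure =
      (∑ v, (G.inDeg v + δ) * h v) / (G.m + δ * G.n) := by
  rw [PMF.integral_eq_sum, Finset.sum_div]
  refine Finset.sum_congr rfl fun v _ => ?_
  rw [chooseByIn_apply_toReal G hδ, smul_eq_mul]
  ring

/-- The mean change of the number of vertices of in-degree `i` when a vertex chosen by in-degree
gains an edge. -/
theorem integral_chooseByIn_upgrade (G : DiMultigraph) {δ : ℝ} (hδ : 0 ≤ δ) (i : ℕ) :
    ∫ v, upgrade i (G.inDeg v) ∂(G.chooseByIn δ).toMeasure =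
      (lag (fun j => ((j : ℝ) + δ) * G.inCount j) i - (i + δ) * G.inCount i) /
        (G.m + δ * G.n) := by
  rw [integral_chooseByIn G hδ]
  congr 1
  have h (j : ℕ) : ∑ v, ((G.inDeg v : ℝ) + δ) * (if G.inDeg v = j then (1 : ℝ) else 0) =
      (j + δ) * G.inCount j := by
    rw [inCount_eq_sum, Finset.mul_sum]
    refine Finset.sum_congr rfl fun v _ => ?_
    split_ifs with hv
    · rw [hv]
    · simp
  simp only [upgrade, mul_sub, Finset.sum_sub_distrib]
  rw [h i]
  congr 1
  cases i with
  | zero => simp [lag]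
  | succ i =>
    simp only [lag, Nat.add_right_cancel_iff]
    exact h i

theorem integral_chooseByOut_upgrade (G : DiMultigraph) {δ : ℝ} (hδ : 0 ≤ δ) (i : ℕ) :
    ∫ v, upgrade i (G.outDeg v) ∂(G.chooseByOut δ).toMeasure =
      (lag (fun j => ((j : ℝ) + δ) * G.outCount j) i - (i + δ) * G.outCount i) /
        (G.m + δ * G.n) :=
  G.reverse.integral_chooseByIn_upgrade hδ i

instance (G : DiMultigraph) : Nonempty (Fin G.m) := ⟨⟨0, G.edge_pos⟩⟩

theorem map_tgt_uniform (G : DiMultigraph) :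
    (PMF.uniformOfFintype (Fin G.m)).map G.tgt = G.chooseByIn 0 := by
  ext v
  have h : ∑' v : Fin G.n, ((G.inDeg v : ℝ≥0∞) + ENNReal.ofReal 0) = G.m := by
    rw [tsum_fintype, ENNReal.ofReal_zero]
    simp only [add_zero]
    rw [← Nat.cast_sum, sum_inDeg]
  rw [PMF.map_apply, chooseByIn, PMF.normalize_apply, h, tsum_fintype]
  simp only [PMF.uniformOfFintype_apply, Fintype.card_fin]
  rw [← Finset.sum_filter, Finset.sum_const, ENNReal.ofReal_zero, add_zero, nsmul_eq_mul, inDeg,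
    inEdges]
  simp only [eq_comm]

theorem map_src_uniform (G : DiMultigraph) :
    (PMF.uniformOfFintype (Fin G.m)).map G.src = G.chooseByOut 0 :=
  G.reverse.map_tgt_uniform

/-- Uniformly resampling the edge among those with the same target preserves the uniform law. -/
theorem uniform_bind_inEdges (G : DiMultigraph) :
    (PMF.uniformOfFintype (Fin G.m)).bind (fun e =>
      PMF.uniformOfFinset (G.inEdges (G.tgt e)) (G.inEdges_tgt_nonempty e)) =
      PMF.uniformOfFintype (Fin G.m) := by
  ext e'
  rw [PMF.bind_apply, tsum_fintype]
  have h (e : Fin G.m) : PMF.uniformOfFintype (Fin G.m) e *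
      PMF.uniformOfFinset (G.inEdges (G.tgt e)) (G.inEdges_tgt_nonempty e) e' =
      if e ∈ G.inEdges (G.tgt e') then
        (G.m : ℝ≥0∞)⁻¹ * ((G.inEdges (G.tgt e')).card : ℝ≥0∞)⁻¹ else 0 := by
    rw [PMF.uniformOfFintype_apply, Fintype.card_fin, PMF.uniformOfFinset_apply]
    have hiff : e' ∈ G.inEdges (G.tgt e) ↔ e ∈ G.inEdges (G.tgt e') := by
      simp [inEdges, eq_comm]
    by_cases he : e ∈ G.inEdges (G.tgt e')
    · have hte : G.tgt e = G.tgt e' := by simpa [inEdges] using he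
      rw [if_pos (hiff.2 he), if_pos he, hte]
    · rw [if_neg (mt hiff.1 he), if_neg he, mul_zero]
  simp only [h]
  rw [← Finset.sum_filter, Finset.sum_const, nsmul_eq_mul, Finset.filter_mem_eq_inter,
    Finset.univ_inter, mul_left_comm, ENNReal.mul_inv_cancel, mul_one, PMF.uniformOfFintype_apply,
    Fintype.card_fin]
  · exact_mod_cast (G.inEdges_tgt_nonempty e').card_pos.ne'
  · simp

theorem uniform_bind_outEdges (G : DiMultigraph) :
    (PMF.uniformOfFintype (Fin G.m)).bind (fun e =>
      PMF.uniformOfFinset (G.outEdges (G.src e)) (G.outEdges_src_nonempty e)) =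
      PMF.uniformOfFintype (Fin G.m) :=
  G.reverse.uniform_bind_inEdges

/-- Choosing a vertex by out-degree and then an edge leaving it is choosing a uniform edge. -/
theorem chooseByOut_bindOnSupport_outEdges (G : DiMultigraph) {T : Type*}
    (K : Fin G.n → Fin G.m → PMF T) :
    ((G.chooseByOut 0).bindOnSupport fun u hu =>
      (PMF.uniformOfFinset (G.outEdges u) (G.outEdges_nonempty_of_mem_support u hu)).bind (K u)) =
      (PMF.uniformOfFintype (Fin G.m)).bind fun e => K (G.src e) e := by
  ext x
  have h : ∑' v : Fin G.n, ((G.outDeg v : ℝ≥0∞) + ENNReal.ofReal 0) = G.m := by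
    rw [tsum_fintype, ENNReal.ofReal_zero]
    simp only [add_zero]
    rw [← Nat.cast_sum]
    exact congrArg _ G.reverse.sum_inDeg
  have hw (u : Fin G.n) : G.chooseByOut 0 u = (G.outEdges u).card * (G.m : ℝ≥0∞)⁻¹ := by
    rw [chooseByOut, PMF.normalize_apply, h, ENNReal.ofReal_zero, add_zero, outDeg]
  rw [PMF.bindOnSupport_apply, PMF.bind_apply, tsum_fintype, tsum_fintype,
    ← Finset.sum_fiberwise Finset.univ G.src]
  refine Finset.sum_congr rfl fun u _ => ?_
  simp only [PMF.uniformOfFintype_apply, Fintype.card_fin]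
  change _ = ∑ e ∈ G.outEdges u, (G.m : ℝ≥0∞)⁻¹ * K (G.src e) e x
  split_ifs with hu
  · rw [hw] at hu
    have hcard : (G.outEdges u).card = 0 := by simpa using hu
    rw [Finset.card_eq_zero.1 hcard]
    simp
  · rw [PMF.bind_apply, tsum_fintype, Finset.mul_sum]
    have hcard : ((G.outEdges u).card : ℝ≥0∞) ≠ 0 := fun h0 => hu (by rw [hw, h0, zero_mul])
    have hterm (e : Fin G.m) : G.chooseByOut 0 u * (PMF.uniformOfFinset (G.outEdges u)
        (G.outEdges_nonempty_of_mem_support u hu) e * K u e x) =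
        if e ∈ G.outEdges u then (G.m : ℝ≥0∞)⁻¹ * K (G.src e) e x else 0 := by
      rw [PMF.uniformOfFinset_apply, hw]
      split_ifs with he
      · have hse : G.src e = u := by simpa [outEdges] using he
        rw [hse, mul_mul_mul_comm, ENNReal.mul_inv_cancel hcard (by simp), one_mul]
      · simp
    simp only [hterm]
    rw [← Finset.sum_filter, Finset.filter_mem_eq_inter, Finset.univ_inter]

/-- The pair of the first and the last edge of the path walked in a K22 event. -/
noncomputable def k22Path (G : DiMultigraph) : PMF (Fin G.m × Fin G.m) :=
  (PMF.uniformOfFintype (Fin G.m)).bind fun e₁ =>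
    (PMF.uniformOfFinset (G.inEdges (G.tgt e₁)) (G.inEdges_tgt_nonempty e₁)).bind fun e₂ =>
      (PMF.uniformOfFinset (G.outEdges (G.src e₂)) (G.outEdges_src_nonempty e₂)).map fun e₃ =>
        (e₁, e₃)

theorem k22Step_eq (G : DiMultigraph) :
    G.k22Step = G.k22Path.bind fun e => PMF.pure (G.addEdge (G.src e.1) (G.tgt e.2)) := by
  rw [k22Step, chooseByOut_bindOnSupport_outEdges, k22Path]
  simp only [PMF.bind_bind, PMF.bind_map, Function.comp_def]

/-- In a K22 event the last edge is marginally uniform, whence the new edge reaches a vertex chosen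
by in-degree. -/
theorem map_tgt_snd_k22Path (G : DiMultigraph) :
    G.k22Path.map (fun e => G.tgt e.2) = G.chooseByIn 0 := by
  rw [← map_tgt_uniform, k22Path]
  simp only [PMF.map_bind, PMF.map_comp, Function.comp_def]
  conv_rhs => rw [← uniform_bind_outEdges, ← uniform_bind_inEdges]
  simp only [PMF.map_bind, PMF.bind_bind]

theorem map_src_fst_k22Path (G : DiMultigraph) :
    G.k22Path.map (fun e => G.src e.1) = G.chooseByOut 0 := by
  rw [← map_src_uniform, k22Path]
  have h (μ : PMF (Fin G.m)) (a : Fin G.n) : μ.map (fun _ => a) = PMF.pure a := μ.map_const a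
  simp only [PMF.map_bind, PMF.map_comp, Function.comp_def, h, PMF.bind_const]
  rfl

end DiMultigraph

/-! ### The degree counts of the model form attachment chains -/

namespace K22Params

open DiMultigraph

variable (θ : K22Params) (G : DiMultigraph)

theorem event_toReal (ev : K22Event) : (θ.event ev).toReal = θ.eventProb ev := by
  rw [event, PMF.ofFintype_apply, ENNReal.toReal_ofReal (θ.eventProb_nonneg ev)]

theorem support_pure_comp_finite {ι : Type*} [Finite ι] (μ : PMF ι) (g : ι → DiMultigraph) :
    (μ.bind fun a => PMF.pure (g a)).support.Finite :=
  PMF.support_bind_finite (Set.toFinite _) fun a => by simp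

theorem integral_bind_pure {ι : Type*} [Finite ι] [MeasurableSpace ι] [DiscreteMeasurableSpace ι]
    (μ : PMF ι) (g : ι → DiMultigraph) (f : DiMultigraph → ℝ) :
    ∫ G', f G' ∂(μ.bind fun a => PMF.pure (g a)).toMeasure = ∫ a, f (g a) ∂μ.toMeasure := by
  rw [PMF.integral_bind_of_finite (Set.toFinite _) fun a => by simp]
  simp only [PMF.integral_pure]

/-- The conditional law of the next graph, given the kind of the event. -/
noncomputable def eventStep : K22Event → PMF DiMultigraph
  | .newSource => (G.chooseByIn θ.δin).bind fun v => PMF.pure (G.addSource v)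
  | .newTarget => (G.chooseByOut θ.δout).bind fun u => PMF.pure (G.addTarget u)
  | .innerEdge => (G.chooseByOut θ.δout).bind fun u =>
      (G.chooseByIn θ.δin).bind fun v => PMF.pure (G.addEdge u v)
  | .k22 => G.k22Step

theorem step_eq : θ.step G = θ.event.bind (θ.eventStep G) := by
  unfold step
  congr 1

theorem eventStep_support_finite (ev : K22Event) : (θ.eventStep G ev).support.Finite := by
  cases ev
  · exact support_pure_comp_finite _ _
  · exact support_pure_comp_finite _ _
  · exact PMF.support_bind_finite (Set.toFinite _) fun u => support_pure_comp_finite _ _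
  · rw [eventStep, k22Step_eq]
    exact support_pure_comp_finite _ _

theorem step_support_finite : (θ.step G).support.Finite := by
  rw [step_eq]
  exact PMF.support_bind_finite (Set.toFinite _) (θ.eventStep_support_finite G)

theorem mem_support_step {G' : DiMultigraph} (h : G' ∈ (θ.step G).support) :
    (∃ v, G' = G.addSource v) ∨ (∃ u, G' = G.addTarget u) ∨ ∃ u v, G' = G.addEdge u v := by
  rw [step_eq, PMF.mem_support_bind_iff] at h
  obtain ⟨ev, -, h⟩ := h
  cases ev
  · rw [eventStep, PMF.mem_support_bind_iff] at h
    obtain ⟨v, -, h⟩ := h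
    exact Or.inl ⟨v, by simpa using h⟩
  · rw [eventStep, PMF.mem_support_bind_iff] at h
    obtain ⟨u, -, h⟩ := h
    exact Or.inr (Or.inl ⟨u, by simpa using h⟩)
  · rw [eventStep, PMF.mem_support_bind_iff] at h
    obtain ⟨u, -, h⟩ := h
    rw [PMF.mem_support_bind_iff] at h
    obtain ⟨v, -, h⟩ := h
    exact Or.inr (Or.inr ⟨u, v, by simpa using h⟩)
  · rw [eventStep, k22Step_eq, PMF.mem_support_bind_iff] at h
    obtain ⟨e, -, h⟩ := h
    exact Or.inr (Or.inr ⟨_, _, by simpa using h⟩)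

theorem integral_step (f : DiMultigraph → ℝ) :
    ∫ G', f G' ∂(θ.step G).toMeasure =
      (1 - θ.p) * θ.α * ∫ v, f (G.addSource v) ∂(G.chooseByIn θ.δin).toMeasure
      + (1 - θ.p) * θ.β * ∫ u, f (G.addTarget u) ∂(G.chooseByOut θ.δout).toMeasure
      + (1 - θ.p) * (1 - θ.α - θ.β) * ∫ u, ∫ v, f (G.addEdge u v)
          ∂(G.chooseByIn θ.δin).toMeasure ∂(G.chooseByOut θ.δout).toMeasure
      + θ.p * ∫ e, f (G.addEdge (G.src e.1) (G.tgt e.2)) ∂G.k22Path.toMeasure := by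
  have h (g : K22Event → ℝ) : ∑ ev, g ev = g .newSource + (g .newTarget +
      (g .innerEdge + (g .k22 + 0))) := rfl
  rw [step_eq, PMF.integral_bind_fintype _ (θ.eventStep_support_finite G), h]
  simp only [event_toReal, eventProb, eventStep, k22Step_eq, integral_bind_pure]
  rw [PMF.integral_bind_of_finite (Set.toFinite _) fun u => support_pure_comp_finite _ _]
  simp only [integral_bind_pure]
  ring

theorem integral_map_k22Path {ι : Type*} [MeasurableSpace ι] [DiscreteMeasurableSpace ι]
    (g : Fin G.m × Fin G.m → ι) (f : ι → ℝ) :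
    ∫ e, f (g e) ∂G.k22Path.toMeasure = ∫ a, f a ∂(G.k22Path.map g).toMeasure := by
  rw [← PMF.bind_pure_comp, PMF.integral_bind_of_finite (Set.toFinite _) fun a => by simp]
  simp only [Function.comp_apply, PMF.integral_pure]

/-- The mechanism ruling the in-degrees. -/
def inParams : AttachmentParams where
  p := θ.p
  q := (1 - θ.p) * (1 - θ.β)
  a₀ := (1 - θ.p) * θ.α
  a₁ := (1 - θ.p) * θ.β
  δ := θ.δin
  p_nonneg := θ.p_nonneg
  q_nonneg := mul_nonneg (by linarith [θ.p_le_one]) (by linarith [θ.add_le_one, θ.α_nonneg])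
  a₀_nonneg := mul_nonneg (by linarith [θ.p_le_one]) θ.α_nonneg
  a₁_nonneg := mul_nonneg (by linarith [θ.p_le_one]) θ.β_nonneg
  δ_nonneg := θ.δin_nonneg

/-- The mechanism ruling the out-degrees. -/
def outParams : AttachmentParams where
  p := θ.p
  q := (1 - θ.p) * (1 - θ.α)
  a₀ := (1 - θ.p) * θ.β
  a₁ := (1 - θ.p) * θ.α
  δ := θ.δout
  p_nonneg := θ.p_nonneg
  q_nonneg := mul_nonneg (by linarith [θ.p_le_one]) (by linarith [θ.add_le_one, θ.β_nonneg])
  a₀_nonneg := mul_nonneg (by linarith [θ.p_le_one]) θ.β_nonneg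
  a₁_nonneg := mul_nonneg (by linarith [θ.p_le_one]) θ.α_nonneg
  δ_nonneg := θ.δout_nonneg

theorem edges_step {G' : DiMultigraph} (h : G' ∈ (θ.step G).support) : G'.m = G.m + 1 := by
  obtain ⟨v, rfl⟩ | ⟨u, rfl⟩ | ⟨u, v, rfl⟩ := θ.mem_support_step G h <;> rfl

theorem abs_size_step_sub_le {G' : DiMultigraph} (h : G' ∈ (θ.step G).support) :
    |(G'.n : ℝ) - G.n| ≤ 1 := by
  obtain ⟨v, rfl⟩ | ⟨u, rfl⟩ | ⟨u, v, rfl⟩ := θ.mem_support_step G h <;>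
    simp [addSource, addTarget, addEdge, addVertex]

theorem mean_size_step :
    ∫ G', (G'.n : ℝ) ∂(θ.step G).toMeasure = G.n + (1 - θ.p) * (θ.α + θ.β) := by
  rw [integral_step]
  simp only [addSource, addTarget, addEdge, addVertex, Nat.cast_add, Nat.cast_one, integral_const,
    probReal_univ, one_smul]
  ring

theorem abs_inCount_step_sub_le (i : ℕ) {G' : DiMultigraph} (h : G' ∈ (θ.step G).support) :
    |(G'.inCount i : ℝ) - G.inCount i| ≤ 2 := by
  have hup (d : ℕ) := abs_le.1 (abs_upgrade_le i d)
  rw [abs_le]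
  obtain ⟨v, rfl⟩ | ⟨u, rfl⟩ | ⟨u, v, rfl⟩ := θ.mem_support_step G h
  · rw [inCount_addSource]
    split_ifs <;> constructor <;> linarith [(hup (G.inDeg v)).1, (hup (G.inDeg v)).2]
  · rw [inCount_addTarget]
    split_ifs <;> constructor <;> linarith
  · rw [inCount_addEdge]
    constructor <;> linarith [(hup (G.inDeg v)).1, (hup (G.inDeg v)).2]

theorem abs_outCount_step_sub_le (i : ℕ) {G' : DiMultigraph} (h : G' ∈ (θ.step G).support) :
    |(G'.outCount i : ℝ) - G.outCount i| ≤ 2 := by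
  have hup (d : ℕ) := abs_le.1 (abs_upgrade_le i d)
  rw [abs_le]
  obtain ⟨v, rfl⟩ | ⟨u, rfl⟩ | ⟨u, v, rfl⟩ := θ.mem_support_step G h
  · rw [outCount_addSource]
    split_ifs <;> constructor <;> linarith
  · rw [outCount_addTarget]
    split_ifs <;> constructor <;> linarith [(hup (G.outDeg u)).1, (hup (G.outDeg u)).2]
  · rw [outCount_addEdge]
    constructor <;> linarith [(hup (G.outDeg u)).1, (hup (G.outDeg u)).2]

theorem isAttachmentKernel_in :
    IsAttachmentKernel θ.inParams θ.step DiMultigraph.m DiMultigraph.n (fun i G => G.inCount i) where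
  finite_support := θ.step_support_finite
  edges_pos := DiMultigraph.edge_pos
  edges_succ G _ := θ.edges_step G
  count_le i G := G.inCount_le i
  abs_size_sub_le G _ := θ.abs_size_step_sub_le G
  abs_count_sub_le i G _ := θ.abs_inCount_step_sub_le G i
  mean_size G := by
    rw [mean_size_step, AttachmentParams.γ, inParams]
    ring
  mean_count i G := by
    rw [integral_step, AttachmentParams.source_eq]
    have hk := integral_map_k22Path G (fun e => G.tgt e.2) fun v => upgrade i (G.inDeg v)
    rw [map_tgt_snd_k22Path, integral_chooseByIn_upgrade G le_rfl] at hk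
    simp only [inCount_addSource, inCount_addTarget, inCount_addEdge,
      add_right_comm _ _ (ite _ _ _), PMF.integral_const_add, hk,
      integral_chooseByIn_upgrade G θ.δin_nonneg, integral_const, probReal_univ, one_smul]
    simp only [inParams, add_zero, zero_mul]
    ring

theorem isAttachmentKernel_out :
    IsAttachmentKernel θ.outParams θ.step DiMultigraph.m DiMultigraph.n
      (fun i G => G.outCount i) where
  finite_support := θ.step_support_finite
  edges_pos := DiMultigraph.edge_pos
  edges_succ G _ := θ.edges_step G
  count_le i G := G.reverse.inCount_le i
  abs_size_sub_le G _ := θ.abs_size_step_sub_le G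
  abs_count_sub_le i G _ := θ.abs_outCount_step_sub_le G i
  mean_size G := by
    rw [mean_size_step, AttachmentParams.γ, outParams]
    ring
  mean_count i G := by
    rw [integral_step, AttachmentParams.source_eq]
    have hk := integral_map_k22Path G (fun e => G.src e.1) fun v => upgrade i (G.outDeg v)
    rw [map_src_fst_k22Path, integral_chooseByOut_upgrade G le_rfl] at hk
    simp only [outCount_addSource, outCount_addTarget, outCount_addEdge,
      add_right_comm _ _ (ite _ _ _), PMF.integral_const_add, hk,
      integral_chooseByOut_upgrade G θ.δout_nonneg, integral_const, probReal_univ, one_smul]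
    simp only [outParams, add_zero, zero_mul]
    ring

end K22Params

/-- The limit theorem for an attachment kernel, uniformly in the initial state. -/
theorem IsAttachmentKernel.exists_power_law {S : Type*} [MeasurableSpace S]
    [DiscreteMeasurableSpace S] {π : AttachmentParams} {κ : S → PMF S} {edges size : S → ℕ}
    {count : ℕ → S → ℕ} (H : IsAttachmentKernel π κ edges size count) {μ : S → ℕ → PMF S}
    (h₀ : ∀ s, μ s 0 = PMF.pure s) (hμ : ∀ s t, μ s (t + 1) = (μ s t).bind κ)
    (hγ : 0 < π.γ) (hA : 0 < π.p + π.c) (h1 : 0 < π.a₀ * (π.c * π.δ) + π.a₁) :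
    ∃ P : ℕ → ℝ,
      (∀ (s : S) (i : ℕ),
        TendstoInProb (μ s) (fun _ s => (count i s : ℝ) / size s) (P i) ∧
        TendstoInProb (μ s) (fun t s => (count i s : ℝ) / (t : ℝ)) (π.γ * P i) ∧
        (∀ t, Integrable (fun s => (count i s : ℝ)) (μ s t).toMeasure) ∧
        Tendsto (fun t : ℕ => (∫ s, (count i s : ℝ) ∂(μ s t).toMeasure) / (t : ℝ)) atTop
          (𝓝 (π.γ * P i))) ∧
      ∃ C : ℝ, 0 < C ∧ P ~[atTop] fun i : ℕ => C * (i : ℝ) ^ (-(1 + 1 / (π.p + π.c))) := by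
  refine ⟨fun i => π.density i / π.γ, fun s i => ?_, ?_⟩
  · have hx : π.γ * (π.density i / π.γ) = π.density i := by field_simp
    rw [hx]
    exact ⟨H.tendstoInProb_count_div_size (h₀ s) (hμ s) hγ i,
      H.tendstoInProb_count_div_time (h₀ s) (hμ s) i,
      fun t => PMF.integrable_of_finite_support (H.law_support_finite (h₀ s) (hμ s) t) _,
      H.tendsto_mean_count_div_time (h₀ s) (hμ s) i⟩
  · obtain ⟨C, hC, h⟩ := π.density_isEquivalent hA (π.density_one_pos h1)
    refine ⟨C / π.γ, by positivity, ?_⟩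
    refine (h.div (IsEquivalent.refl (u := fun _ : ℕ => π.γ))).congr_right
      (Eventually.of_forall fun i => ?_)
    simp only [Pi.div_apply]
    ring
theorem mainTheorem1 (θ : K22Params) (hp : θ.p < 1) (hαβ : 0 < θ.α + θ.β) :
    ((0 < θ.p ∨ θ.β < 1) → 0 < θ.α * θ.δin + θ.β →
      ∃ P : ℕ → ℝ,
        (∀ (G₀ : DiMultigraph) (i : ℕ),
          TendstoInProb (θ.law G₀) (fun _ G => (G.inCount i : ℝ) / (G.n : ℝ)) (P i) ∧
          TendstoInProb (θ.law G₀) (fun t G => (G.inCount i : ℝ) / (t : ℝ))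
            ((1 - θ.p) * (θ.α + θ.β) * P i) ∧
          (∀ t, Integrable (fun G => (G.inCount i : ℝ)) (θ.law G₀ t).toMeasure) ∧
          Tendsto (fun t : ℕ => (∫ G, (G.inCount i : ℝ) ∂(θ.law G₀ t).toMeasure) / (t : ℝ)) atTop
            (𝓝 ((1 - θ.p) * (θ.α + θ.β) * P i))) ∧
        ∃ C : ℝ, 0 < C ∧
          P ~[atTop] fun i : ℕ => C * (i : ℝ) ^ (-(1 + 1 / θ.A))) ∧
    ((0 < θ.p ∨ θ.α < 1) → 0 < θ.β * θ.δout + θ.α →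
      ∃ P : ℕ → ℝ,
        (∀ (G₀ : DiMultigraph) (o : ℕ),
          TendstoInProb (θ.law G₀) (fun _ G => (G.outCount o : ℝ) / (G.n : ℝ)) (P o) ∧
          TendstoInProb (θ.law G₀) (fun t G => (G.outCount o : ℝ) / (t : ℝ))
            ((1 - θ.p) * (θ.α + θ.β) * P o) ∧
          (∀ t, Integrable (fun G => (G.outCount o : ℝ)) (θ.law G₀ t).toMeasure) ∧
          Tendsto (fun t : ℕ => (∫ G, (G.outCount o : ℝ) ∂(θ.law G₀ t).toMeasure) / (t : ℝ)) atTop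
            (𝓝 ((1 - θ.p) * (θ.α + θ.β) * P o))) ∧
        ∃ C : ℝ, 0 < C ∧
          P ~[atTop] fun o : ℕ => C * (o : ℝ) ^ (-(1 + 1 / θ.B))) := by
  have hp' : 0 < 1 - θ.p := by linarith
  have hγ : 0 < (1 - θ.p) * (θ.α + θ.β) := mul_pos hp' hαβ
  have hα := θ.α_nonneg
  have hβ := θ.β_nonneg
  -- If vertices of degree one never arrive as such, then `q > 0`, so that vertices of degree zero
  -- are upgraded at positive rate.
  have hone (π : AttachmentParams) {a b : ℝ} (ha : 0 ≤ a) (hb : 0 ≤ b)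
      (ha₀ : π.a₀ = (1 - θ.p) * a) (ha₁ : π.a₁ = (1 - θ.p) * b)
      (hq : π.q = (1 - θ.p) * (1 - b)) (hpos : 0 < a * π.δ + b) :
      0 < π.a₀ * (π.c * π.δ) + π.a₁ := by
    have hc := π.c_nonneg
    have hδ := π.δ_nonneg
    rw [ha₀, ha₁]
    rcases hb.lt_or_eq with hb' | hb'
    · positivity
    · rw [← hb', add_zero] at hpos
      have hc' : 0 < π.c := by
        refine div_pos ?_ π.one_add_pos
        rw [hq, ← hb']
        linarith
      have := mul_pos (mul_pos hp' hpos) hc'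
      rw [← hb']
      linarith
  have hrate (π : AttachmentParams) {b : ℝ} (hq : π.q = (1 - θ.p) * (1 - b))
      (h : 0 < π.p ∨ b < 1) : 0 < π.p + π.c := by
    rcases h with h | h
    · linarith [π.c_nonneg]
    · have : 0 < π.c := div_pos (by rw [hq]; exact mul_pos hp' (by linarith)) π.one_add_pos
      linarith [π.p_nonneg]
  constructor
  · intro h1 h2
    have hγeq : θ.inParams.γ = (1 - θ.p) * (θ.α + θ.β) := (mul_add _ _ _).symm
    have hA : θ.inParams.p + θ.inParams.c = θ.A := by
      rw [AttachmentParams.c, hγeq]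
      rfl
    have h := θ.isAttachmentKernel_in.exists_power_law (μ := θ.law) (fun _ => rfl)
      (fun _ _ => rfl) (hγeq ▸ hγ) (hrate _ rfl h1) (hone _ hα hβ rfl rfl rfl h2)
    rwa [hγeq, hA] at h
  · intro h1 h2
    have hγeq : θ.outParams.γ = (1 - θ.p) * (θ.α + θ.β) := by
      rw [add_comm θ.α]
      exact (mul_add _ _ _).symm
    have hB : θ.outParams.p + θ.outParams.c = θ.B := by
      rw [AttachmentParams.c, hγeq]
      rfl
    have h := θ.isAttachmentKernel_out.exists_power_law (μ := θ.law) (fun _ => rfl)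
      (fun _ _ => rfl) (hγeq ▸ hγ) (hrate _ rfl h1) (hone _ hβ hα rfl rfl rfl h2)
    rwa [hγeq, hB] at h
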